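/- Let $K$ be a field. Let $E$ be a bialgebra over $K$ (not assumed to have an antipode) and let $H\subseteq E$ be a Hopf subalgebra, i.e. a subalgebra with $\Delta(H)\subseteq H\otimes H$ which, with the bialgebra structure inherited from $E$, is a Hopf algebra. Assume that (i) $H$ is formally smooth as a $K$-coalgebra, i.e. the $H$-bicomodule $\mho_1 H:=\mathrm{Coker}(\Delta\colon H\to H\otimes H)$ is injective with respect to all morphisms of $H$-bicomodules that have a $K$-linear retraction; here $H\otimes H$ is an $H$-bicomodule via $\Delta\otimes H$ and $H\otimes\Delta$, and $\mho_1H$ carries the quotient structure; (ii) $\mathrm{Corad}(E)\subseteq H$, where $\mathrm{Corad}(E)$ is the sum of all simple subcoalgebras of $E$. Then $E$ has a weak projection onto $H$: there is a coalgebra homomorphism $\pi\colon E\to H$ such that $\pi(h)=h$ and $\pi(he)=h\,\pi(e)$ for all $h\in H$ and $e\in E$. -/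

import Mathlib

open scoped TensorProduct

universe u v

noncomputable section

/-! ### Subcoalgebras and the coradical -/

/-- A subspace `D` of a `K`-coalgebra `C` is a subcoalgebra if `Δ(D) ⊆ D ⊗ D`, where `D ⊗ D` is
regarded as a subspace of `C ⊗ C`. -/
def IsSubcoalgebra (K : Type u) {C : Type v} [Field K] [AddCommGroup C] [Module K C]
    [Coalgebra K C] (D : Submodule K C) : Prop :=
  ∀ x ∈ D, Coalgebra.comul (R := K) x ∈
    LinearMap.range (TensorProduct.map D.subtype D.subtype)

/-- A subcoalgebra is simple if it is nonzero and its only subcoalgebras are `0` and itself. -/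
structure IsSimpleSubcoalgebra (K : Type u) {C : Type v} [Field K] [AddCommGroup C] [Module K C]
    [Coalgebra K C] (D : Submodule K C) : Prop where
  isSubcoalgebra : IsSubcoalgebra K D
  ne_bot : D ≠ ⊥
  eq_bot_or_eq : ∀ D' : Submodule K C, IsSubcoalgebra K D' → D' ≤ D → D' = ⊥ ∨ D' = D

/-- The coradical of a coalgebra: the sum of all its simple subcoalgebras. -/
def Corad (K : Type u) (C : Type v) [Field K] [AddCommGroup C] [Module K C]
    [Coalgebra K C] : Submodule K C :=
  sSup {D | IsSimpleSubcoalgebra K D}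

/-! ### Bicomodules -/

/-- A `C`-bicomodule structure on the `K`-vector space `M`. -/
structure Bicomodule (K : Type u) (C : Type v) [Field K] [AddCommGroup C] [Module K C]
    [Coalgebra K C] (M : Type v) [AddCommGroup M] [Module K M] where
  /-- the left coaction -/
  coactL : M →ₗ[K] C ⊗[K] M
  /-- the right coaction -/
  coactR : M →ₗ[K] M ⊗[K] C
  coassocL : TensorProduct.assoc K C C M ∘ₗ Coalgebra.comul.rTensor M ∘ₗ coactL =
    coactL.lTensor C ∘ₗ coactL
  counitL : Coalgebra.counit.rTensor M ∘ₗ coactL = TensorProduct.mk K K M 1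
  coassocR : TensorProduct.assoc K M C C ∘ₗ coactR.rTensor C ∘ₗ coactR =
    Coalgebra.comul.lTensor M ∘ₗ coactR
  counitR : Coalgebra.counit.lTensor M ∘ₗ coactR = (TensorProduct.mk K M K).flip 1
  coactL_coactR : TensorProduct.assoc K C M C ∘ₗ coactL.rTensor C ∘ₗ coactR =
    coactR.lTensor C ∘ₗ coactL

namespace Bicomodule

variable {K : Type u} {C : Type v} [Field K] [AddCommGroup C] [Module K C] [Coalgebra K C]
  {M N : Type v} [AddCommGroup M] [Module K M] [AddCommGroup N] [Module K N]

/-- A linear map is a morphism of bicomodules if it is left and right colinear. -/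
structure IsHom (X : Bicomodule K C M) (Y : Bicomodule K C N) (f : M →ₗ[K] N) : Prop where
  left : Y.coactL ∘ₗ f = f.lTensor C ∘ₗ X.coactL
  right : Y.coactR ∘ₗ f = f.rTensor C ∘ₗ X.coactR

/-- If `q : M → N` is surjective and two linear maps `ρL : N → C ⊗ N` and `ρR : N → N ⊗ C` are
compatible through `q` with a bicomodule structure on `M`, then they form a bicomodule structure
on `N`. -/
@[simps coactL coactR]
def ofSurjective (X : Bicomodule K C M) (q : M →ₗ[K] N) (hq : Function.Surjective q)
    (ρL : N →ₗ[K] C ⊗[K] N) (ρR : N →ₗ[K] N ⊗[K] C)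
    (hL : ρL ∘ₗ q = q.lTensor C ∘ₗ X.coactL) (hR : ρR ∘ₗ q = q.rTensor C ∘ₗ X.coactR) :
    Bicomodule K C N where
  coactL := ρL
  coactR := ρR
  coassocL := by
    rw [← LinearMap.cancel_right hq]
    have h := congrArg (fun t => (q.lTensor C).lTensor C ∘ₗ t) X.coassocL
    simp only [coassoc_simps] at h hL ⊢
    simp only [hL, coassoc_simps, h]
  counitL := by
    rw [← LinearMap.cancel_right hq]
    have h := congrArg (fun t => q.lTensor K ∘ₗ t) X.counitL
    simp only [coassoc_simps] at h hL ⊢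
    simp only [hL, coassoc_simps, h]
    rfl
  coassocR := by
    rw [← LinearMap.cancel_right hq]
    have h := congrArg (fun t => (TensorProduct.map q LinearMap.id) ∘ₗ t) X.coassocR
    simp only [coassoc_simps] at h hR ⊢
    simp only [hR, coassoc_simps, h]
  counitR := by
    rw [← LinearMap.cancel_right hq]
    have h := congrArg (fun t => q.rTensor K ∘ₗ t) X.counitR
    simp only [coassoc_simps] at h hR ⊢
    simp only [hR, coassoc_simps, h]
    rfl
  coactL_coactR := by
    rw [← LinearMap.cancel_right hq]
    have h := congrArg (fun t => (q.rTensor C).lTensor C ∘ₗ t) X.coactL_coactR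
    simp only [coassoc_simps] at h hL hR ⊢
    simp only [hL, hR, coassoc_simps, h]

variable (K C)

/-- The bicomodule `C ⊗ C`, with coactions `Δ ⊗ C` and `C ⊗ Δ`. -/
@[simps coactL coactR]
def tensorSelf : Bicomodule K C (C ⊗[K] C) where
  coactL := TensorProduct.assoc K C C C ∘ₗ Coalgebra.comul.rTensor C
  coactR := (TensorProduct.assoc K C C C).symm ∘ₗ Coalgebra.comul.lTensor C
  coassocL := by
    refine TensorProduct.ext' fun c d => ?_
    let φ : (C ⊗[K] C) →ₗ[K] C ⊗[K] (C ⊗[K] C) :=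
      (TensorProduct.assoc K C C C).toLinearMap ∘ₗ (TensorProduct.mk K (C ⊗[K] C) C).flip d
    have h1 : ∀ z : C ⊗[K] C, TensorProduct.assoc K C C (C ⊗[K] C)
        ((Coalgebra.comul (R := K)).rTensor (C ⊗[K] C) (TensorProduct.assoc K C C C (z ⊗ₜ d))) =
        φ.lTensor C (TensorProduct.assoc K C C C ((Coalgebra.comul (R := K)).rTensor C z)) := by
      intro z
      induction z with
      | zero => simp
      | add x y hx hy => simp only [TensorProduct.add_tmul, map_add, hx, hy]
      | tmul a b =>
        simp only [LinearMap.rTensor_tmul, TensorProduct.assoc_tmul]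
        generalize (Coalgebra.comul (R := K) a) = w
        induction w with
        | zero => simp
        | add x y hx hy => simp only [TensorProduct.add_tmul, map_add, hx, hy]
        | tmul p q => rfl
    have h2 : ∀ z : C ⊗[K] C, ((TensorProduct.assoc K C C C).toLinearMap ∘ₗ
        (Coalgebra.comul (R := K)).rTensor C).lTensor C (TensorProduct.assoc K C C C (z ⊗ₜ d)) =
        φ.lTensor C ((Coalgebra.comul (R := K)).lTensor C z) := by
      intro z
      induction z with
      | zero => simp
      | add x y hx hy => simp only [TensorProduct.add_tmul, map_add, hx, hy]
      | tmul a b => rfl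
    exact (h1 _).trans ((congrArg _ (Coalgebra.coassoc_apply c)).trans (h2 _).symm)
  counitL := by
    refine TensorProduct.ext' fun c d => ?_
    have h1 : ∀ z : C ⊗[K] C, (Coalgebra.counit (R := K)).rTensor (C ⊗[K] C)
        (TensorProduct.assoc K C C C (z ⊗ₜ d)) =
        ((TensorProduct.mk K C C).flip d).lTensor K ((Coalgebra.counit (R := K)).rTensor C z) := by
      intro z
      induction z with
      | zero => simp
      | add x y hx hy => simp only [TensorProduct.add_tmul, map_add, hx, hy]
      | tmul a b => rfl
    exact (h1 _).trans (congrArg _ (Coalgebra.rTensor_counit_comul c))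
  coassocR := by
    refine TensorProduct.ext' fun c d => ?_
    let φ : C ⊗[K] (C ⊗[K] C) →ₗ[K] (C ⊗[K] C) ⊗[K] (C ⊗[K] C) :=
      (TensorProduct.assoc K C C (C ⊗[K] C)).symm.toLinearMap ∘ₗ
        TensorProduct.mk K C (C ⊗[K] (C ⊗[K] C)) c
    have h1 : ∀ z : C ⊗[K] C, TensorProduct.assoc K (C ⊗[K] C) C C
        (((TensorProduct.assoc K C C C).symm.toLinearMap ∘ₗ
          (Coalgebra.comul (R := K)).lTensor C).rTensor C
            ((TensorProduct.assoc K C C C).symm (c ⊗ₜ z))) =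
        φ (TensorProduct.assoc K C C C ((Coalgebra.comul (R := K)).rTensor C z)) := by
      intro z
      induction z with
      | zero => simp
      | add x y hx hy => simp only [TensorProduct.tmul_add, map_add, hx, hy]
      | tmul a b =>
        simp only [LinearMap.rTensor_tmul, LinearMap.lTensor_tmul, TensorProduct.assoc_symm_tmul,
          LinearMap.comp_apply, LinearEquiv.coe_coe]
        generalize (Coalgebra.comul (R := K) a) = w
        induction w with
        | zero => simp
        | add x y hx hy =>
          simp only [TensorProduct.add_tmul, TensorProduct.tmul_add, map_add, hx, hy]
        | tmul p q => rfl
    have h2 : ∀ z : C ⊗[K] C, (Coalgebra.comul (R := K)).lTensor (C ⊗[K] C)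
        ((TensorProduct.assoc K C C C).symm (c ⊗ₜ z)) =
        φ ((Coalgebra.comul (R := K)).lTensor C z) := by
      intro z
      induction z with
      | zero => simp
      | add x y hx hy => simp only [TensorProduct.tmul_add, map_add, hx, hy]
      | tmul a b => rfl
    exact (h1 _).trans ((congrArg _ (Coalgebra.coassoc_apply d)).trans (h2 _).symm)
  counitR := by
    refine TensorProduct.ext' fun c d => ?_
    have h1 : ∀ z : C ⊗[K] C, (Coalgebra.counit (R := K)).lTensor (C ⊗[K] C)
        ((TensorProduct.assoc K C C C).symm (c ⊗ₜ z)) =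
        (TensorProduct.assoc K C C K).symm (c ⊗ₜ (Coalgebra.counit (R := K)).lTensor C z) := by
      intro z
      induction z with
      | zero => simp
      | add x y hx hy => simp only [TensorProduct.tmul_add, map_add, hx, hy]
      | tmul a b => rfl
    refine (h1 _).trans ?_
    rw [Coalgebra.lTensor_counit_comul]
    rfl
  coactL_coactR := by
    refine TensorProduct.ext' fun c d => ?_
    have h1 : ∀ z : C ⊗[K] C, TensorProduct.assoc K C (C ⊗[K] C) C
        (((TensorProduct.assoc K C C C).toLinearMap ∘ₗ
          (Coalgebra.comul (R := K)).rTensor C).rTensor C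
            ((TensorProduct.assoc K C C C).symm (c ⊗ₜ z))) =
        (TensorProduct.assoc K C C C).symm.toLinearMap.lTensor C
          (TensorProduct.assoc K C C (C ⊗[K] C) (Coalgebra.comul (R := K) c ⊗ₜ z)) := by
      intro z
      induction z with
      | zero => simp
      | add x y hx hy => simp only [TensorProduct.tmul_add, map_add, hx, hy]
      | tmul a b =>
        simp only [LinearMap.rTensor_tmul, TensorProduct.assoc_symm_tmul,
          LinearMap.comp_apply, LinearEquiv.coe_coe]
        generalize (Coalgebra.comul (R := K) c) = w
        induction w with
        | zero => simp
        | add x y hx hy => simp only [TensorProduct.add_tmul, map_add, hx, hy]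
        | tmul p q => rfl
    have h2 : ∀ z : C ⊗[K] C, ((TensorProduct.assoc K C C C).symm.toLinearMap ∘ₗ
        (Coalgebra.comul (R := K)).lTensor C).lTensor C (TensorProduct.assoc K C C C (z ⊗ₜ d)) =
        (TensorProduct.assoc K C C C).symm.toLinearMap.lTensor C
          (TensorProduct.assoc K C C (C ⊗[K] C) (z ⊗ₜ Coalgebra.comul (R := K) d)) := by
      intro z
      induction z with
      | zero => simp
      | add x y hx hy => simp only [TensorProduct.add_tmul, map_add, hx, hy]
      | tmul a b => rfl
    exact (h1 _).trans (h2 _).symm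

/-- `℧₁ C`, the cokernel of the comultiplication `Δ : C → C ⊗ C`. -/
abbrev CokerComul : Type v :=
  (C ⊗[K] C) ⧸ LinearMap.range (Coalgebra.comul (R := K) (A := C))

/-- The quotient map `C ⊗ C → ℧₁ C`. -/
abbrev cokerComulMk : C ⊗[K] C →ₗ[K] CokerComul K C :=
  (LinearMap.range (Coalgebra.comul (R := K) (A := C))).mkQ

/-- The bicomodule structure of `℧₁ C` induced by that of `C ⊗ C`. -/
def cokerComul : Bicomodule K C (CokerComul K C) :=
  (tensorSelf K C).ofSurjective (cokerComulMk K C) (Submodule.mkQ_surjective _)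
    (Submodule.liftQ _ ((cokerComulMk K C).lTensor C ∘ₗ (tensorSelf K C).coactL) (by
      rw [LinearMap.range_le_ker_iff, tensorSelf_coactL, LinearMap.comp_assoc,
        LinearMap.comp_assoc, Coalgebra.coassoc, ← LinearMap.comp_assoc, ← LinearMap.lTensor_comp,
        LinearMap.range_mkQ_comp, LinearMap.lTensor_zero, LinearMap.zero_comp]))
    (Submodule.liftQ _ ((cokerComulMk K C).rTensor C ∘ₗ (tensorSelf K C).coactR) (by
      rw [LinearMap.range_le_ker_iff, tensorSelf_coactR, LinearMap.comp_assoc,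
        LinearMap.comp_assoc, Coalgebra.coassoc_symm, ← LinearMap.comp_assoc,
        ← LinearMap.rTensor_comp, LinearMap.range_mkQ_comp, LinearMap.rTensor_zero,
        LinearMap.zero_comp]))
    (Submodule.liftQ_mkQ _ _ _) (Submodule.liftQ_mkQ _ _ _)

/-- The quotient map `C ⊗ C → ℧₁ C` is a morphism of bicomodules. -/
theorem isHom_cokerComulMk :
    IsHom (tensorSelf K C) (cokerComul K C) (cokerComulMk K C) :=
  ⟨Submodule.liftQ_mkQ _ _ _, Submodule.liftQ_mkQ _ _ _⟩

end Bicomodule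

/-- A bicomodule `I` is relatively injective if it is injective with respect to all morphisms of
bicomodules `i : X → Y` that have a `K`-linear retraction. -/
def Bicomodule.IsRelInjective {K : Type u} {C : Type v} [Field K] [AddCommGroup C] [Module K C]
    [Coalgebra K C] {I : Type v} [AddCommGroup I] [Module K I] (bI : Bicomodule K C I) : Prop :=
  ∀ (X Y : Type v) [AddCommGroup X] [Module K X] [AddCommGroup Y] [Module K Y]
    (bX : Bicomodule K C X) (bY : Bicomodule K C Y) (i : X →ₗ[K] Y),
    Bicomodule.IsHom bX bY i → (∃ r : Y →ₗ[K] X, r ∘ₗ i = LinearMap.id) →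
    ∀ f : X →ₗ[K] I, Bicomodule.IsHom bX bI f →
      ∃ g : Y →ₗ[K] I, Bicomodule.IsHom bY bI g ∧ g ∘ₗ i = f

/-- A `K`-coalgebra `C` is formally smooth if the `C`-bicomodule `℧₁ C` is relatively injective. -/
def IsFormallySmoothCoalgebra (K : Type u) (C : Type v) [Field K] [AddCommGroup C] [Module K C]
    [Coalgebra K C] : Prop :=
  (Bicomodule.cokerComul K C).IsRelInjective

/-! ### Hopf subalgebras -/

section Restrict

variable {K : Type u} {C D : Type v} [Field K] [AddCommGroup C] [Module K C] [Coalgebra K C]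
  [AddCommGroup D] [Module K D]

/-- The comultiplication of `C` restricted along an injective linear map `i : D → C` such that
`Δ(i(D)) ⊆ i(D) ⊗ i(D)`. -/
def restrictComul (i : D →ₗ[K] C) (hi : Function.Injective i)
    (h : ∀ x, Coalgebra.comul (R := K) (i x) ∈ LinearMap.range (TensorProduct.map i i)) :
    D →ₗ[K] D ⊗[K] D :=
  (LinearEquiv.ofInjective (TensorProduct.map i i)
      (TensorProduct.map_injective_of_flat_flat i i hi hi)).symm.toLinearMap ∘ₗ
    (Coalgebra.comul (R := K) ∘ₗ i).codRestrict _ h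

theorem map_comp_restrictComul (i : D →ₗ[K] C) (hi : Function.Injective i)
    (h : ∀ x, Coalgebra.comul (R := K) (i x) ∈ LinearMap.range (TensorProduct.map i i)) :
    TensorProduct.map i i ∘ₗ restrictComul i hi h = Coalgebra.comul ∘ₗ i := by
  ext x
  simp only [restrictComul, LinearMap.comp_apply, LinearEquiv.coe_coe]
  exact congrArg Subtype.val (LinearEquiv.apply_symm_apply
    (LinearEquiv.ofInjective (TensorProduct.map i i)
      (TensorProduct.map_injective_of_flat_flat i i hi hi)) _)

/-- The coalgebra structure restricted along `i : D → C` as in `restrictComul`. -/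
abbrev restrictCoalgebra (i : D →ₗ[K] C) (hi : Function.Injective i)
    (h : ∀ x, Coalgebra.comul (R := K) (i x) ∈ LinearMap.range (TensorProduct.map i i)) :
    Coalgebra K D where
  comul := restrictComul i hi h
  counit := Coalgebra.counit ∘ₗ i
  coassoc := by
    have hm := map_comp_restrictComul i hi h
    have hinj : Function.Injective (TensorProduct.map i (TensorProduct.map i i)) :=
      TensorProduct.map_injective_of_flat_flat _ _ hi
        (TensorProduct.map_injective_of_flat_flat i i hi hi)
    rw [← LinearMap.cancel_left hinj]
    have e1 : TensorProduct.map (Coalgebra.comul (R := K) ∘ₗ i) i =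
        Coalgebra.comul.rTensor C ∘ₗ TensorProduct.map i i := by
      rw [LinearMap.rTensor, ← TensorProduct.map_comp, LinearMap.id_comp]
    have e2 : TensorProduct.map i (Coalgebra.comul (R := K) ∘ₗ i) =
        Coalgebra.comul.lTensor C ∘ₗ TensorProduct.map i i := by
      rw [LinearMap.lTensor, ← TensorProduct.map_comp, LinearMap.id_comp]
    rw [← LinearMap.comp_assoc, TensorProduct.map_map_comp_assoc_eq, LinearMap.comp_assoc,
      ← LinearMap.comp_assoc _ _ (TensorProduct.map (TensorProduct.map i i) i), LinearMap.rTensor,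
      ← TensorProduct.map_comp, hm, LinearMap.comp_id, e1, LinearMap.comp_assoc, hm,
      ← LinearMap.comp_assoc _ _ (TensorProduct.map i (TensorProduct.map i i)), LinearMap.lTensor,
      ← TensorProduct.map_comp, hm, LinearMap.comp_id, e2, LinearMap.comp_assoc, hm,
      ← LinearMap.comp_assoc, ← LinearMap.comp_assoc, LinearMap.comp_assoc _ _
      (TensorProduct.assoc K C C C).toLinearMap, Coalgebra.coassoc, LinearMap.comp_assoc]
  rTensor_counit_comp_comul := by
    have hm := map_comp_restrictComul i hi h
    have hinj : Function.Injective (i.lTensor K) :=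
      Module.Flat.lTensor_preserves_injective_linearMap i hi
    rw [← LinearMap.cancel_left hinj]
    have e : i.lTensor K ∘ₗ (Coalgebra.counit (R := K) ∘ₗ i).rTensor D =
        Coalgebra.counit.rTensor C ∘ₗ TensorProduct.map i i := by
      simp only [coassoc_simps]
    rw [← LinearMap.comp_assoc, e, LinearMap.comp_assoc, hm, ← LinearMap.comp_assoc,
      Coalgebra.rTensor_counit_comp_comul]
    rfl
  lTensor_counit_comp_comul := by
    have hm := map_comp_restrictComul i hi h
    have hinj : Function.Injective (i.rTensor K) :=
      Module.Flat.rTensor_preserves_injective_linearMap i hi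
    rw [← LinearMap.cancel_left hinj]
    have e : i.rTensor K ∘ₗ (Coalgebra.counit (R := K) ∘ₗ i).lTensor D =
        Coalgebra.counit.lTensor C ∘ₗ TensorProduct.map i i := by
      simp only [coassoc_simps]
    rw [← LinearMap.comp_assoc, e, LinearMap.comp_assoc, hm, ← LinearMap.comp_assoc,
      Coalgebra.lTensor_counit_comp_comul]
    rfl

end Restrict

/-- A sub-bialgebra of `E`: a subalgebra that is also a subcoalgebra. -/
structure Subbialgebra (K : Type u) (E : Type v) [Field K] [Ring E] [Bialgebra K E] extends
    Subalgebra K E where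
  isSubcoalgebra : IsSubcoalgebra K (Subalgebra.toSubmodule toSubalgebra)

namespace Subbialgebra

variable {K : Type u} {E : Type v} [Field K] [Ring E] [Bialgebra K E]

instance instCoalgebra (B : Subbialgebra K E) : Coalgebra K B.toSubalgebra :=
  restrictCoalgebra B.toSubalgebra.val.toLinearMap Subtype.val_injective
    (fun x => B.isSubcoalgebra x x.2)

theorem map_val_comul (B : Subbialgebra K E) (x : B.toSubalgebra) :
    Algebra.TensorProduct.map B.toSubalgebra.val B.toSubalgebra.val
      (Coalgebra.comul (R := K) x) = Coalgebra.comul (R := K) (x : E) :=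
  LinearMap.congr_fun (map_comp_restrictComul B.toSubalgebra.val.toLinearMap
    Subtype.val_injective (fun x => B.isSubcoalgebra x x.2)) x

theorem counit_coe (B : Subbialgebra K E) (x : B.toSubalgebra) :
    Coalgebra.counit (R := K) x = Coalgebra.counit (R := K) (x : E) :=
  rfl

theorem map_val_injective (B : Subbialgebra K E) : Function.Injective
    (Algebra.TensorProduct.map B.toSubalgebra.val B.toSubalgebra.val) :=
  TensorProduct.map_injective_of_flat_flat B.toSubalgebra.val.toLinearMap
    B.toSubalgebra.val.toLinearMap Subtype.val_injective Subtype.val_injective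

/-- The bialgebra structure that a sub-bialgebra inherits. -/
instance instBialgebra (B : Subbialgebra K E) : Bialgebra K B.toSubalgebra :=
  Bialgebra.mk' K B.toSubalgebra
    (Bialgebra.counit_one (R := K) (A := E))
    (fun {a b} => Bialgebra.counit_mul (R := K) (a : E) (b : E))
    (B.map_val_injective (by
      rw [B.map_val_comul, map_one, OneMemClass.coe_one, Bialgebra.comul_one]))
    (fun {a b} => B.map_val_injective (by
      rw [B.map_val_comul, map_mul, B.map_val_comul, B.map_val_comul, MulMemClass.coe_mul,
        Bialgebra.comul_mul]))

end Subbialgebra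

/-- A Hopf subalgebra of a bialgebra `E`: a sub-bialgebra that is a Hopf algebra, that is, has an
antipode. (The bialgebra `E` itself need not have one.) -/
structure HopfSubalgebra (K : Type u) (E : Type v) [Field K] [Ring E] [Bialgebra K E] where
  toSubbialgebra : Subbialgebra K E
  antipode : toSubbialgebra.toSubalgebra →ₗ[K] toSubbialgebra.toSubalgebra
  mul_antipode_rTensor_comul :
    LinearMap.mul' K toSubbialgebra.toSubalgebra ∘ₗ
        antipode.rTensor toSubbialgebra.toSubalgebra ∘ₗ Coalgebra.comul =
      Algebra.linearMap K toSubbialgebra.toSubalgebra ∘ₗ Coalgebra.counit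
  mul_antipode_lTensor_comul :
    LinearMap.mul' K toSubbialgebra.toSubalgebra ∘ₗ
        antipode.lTensor toSubbialgebra.toSubalgebra ∘ₗ Coalgebra.comul =
      Algebra.linearMap K toSubbialgebra.toSubalgebra ∘ₗ Coalgebra.counit

namespace HopfSubalgebra

variable {K : Type u} {E : Type v} [Field K] [Ring E] [Bialgebra K E]

/-- The underlying subalgebra of a Hopf subalgebra. -/
abbrev toSubalgebra (H : HopfSubalgebra K E) : Subalgebra K E :=
  H.toSubbialgebra.toSubalgebra

instance instHopfAlgebra (H : HopfSubalgebra K E) : HopfAlgebra K H.toSubalgebra where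
  antipode := H.antipode
  mul_antipode_rTensor_comul := H.mul_antipode_rTensor_comul
  mul_antipode_lTensor_comul := H.mul_antipode_lTensor_comul

/-- A weak projection onto `H`: a left `H`-linear coalgebra map `π : E → H` that is a retraction
of the inclusion `H → E`. -/
structure IsWeakProjection (H : HopfSubalgebra K E) (π : E →ₗc[K] H.toSubalgebra) : Prop where
  map_coe : ∀ h : H.toSubalgebra, π (h : E) = h
  map_coe_mul : ∀ (h : H.toSubalgebra) (e : E), π ((h : E) * e) = h * π e

end HopfSubalgebra

end

/-! Write `A` for the Hopf algebra `H`, `ι : A → E` for its inclusion, and filter `E` by the wedge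
powers of `H`. The proof deforms a linear retraction `p : E → A`, one layer of the filtration at a
time. Each deformation leaves `p` unchanged on the layers already treated, so the successive maps
have a limit (`exists_linearMap_limit`).

The layers exhaust `E` (`exists_mem_wedgePow`). Otherwise the quotient by their union `F` would
contain a simple subcomodule. Right slices by functionals vanishing on `F` send it to `0` or to a
simple left coideal, hence into the coradical (`le_corad_of_isSimpleModule`), hence into `H`. This
pushes a nonzero class into `H ∧ F`, which is already contained in `F`.

The first deformation makes `p` left `A`-linear (`exists_linear_retraction`). The defect `D(h ⊗ y) =
p(hy) - h p(y)` satisfies a cocycle identity, and averaging with the antipode writes it as a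
coboundary on the next layer. No smoothness is needed here.

The second makes `p` comultiplicative (`exists_weak_projection`). Smoothness supplies a bicolinear
retraction of the left coaction of `℧₁ A`. Together with the universal coderivation it gives a map
`ψ` on `A ⊗ A` (`IsFormallySmoothCoalgebra.exists_coderivation`). Averaging, `θ(a ⊗ z) = a₁ ψ(S(a₂)
z)`, makes it linear for the diagonal action without losing its coderivation properties
(`IsSplittingMap`). Replacing `p` by `x ↦ p(x) + θ(p(x₁) ⊗ p(x₂) ⊗ p(x₃))` then kills the
comultiplicative defect on the next layer and preserves linearity, the counit and the values on `H`.
-/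

noncomputable section

open Coalgebra (comul counit coassoc_apply coassoc_symm_apply)

/-! ### Slices of the comultiplication by functionals -/

section Slices

variable {K : Type u} {C : Type v} [Field K] [AddCommGroup C] [Module K C] [Coalgebra K C]

/-- The map `x ↦ f(x₁) x₂`. -/
def leftSlice (f : Module.Dual K C) : C →ₗ[K] C :=
  TensorProduct.lid K C ∘ₗ f.rTensor C ∘ₗ comul

/-- The map `x ↦ x₁ f(x₂)`. -/
def rightSlice (f : Module.Dual K C) : C →ₗ[K] C :=
  TensorProduct.rid K C ∘ₗ f.lTensor C ∘ₗ comul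

/-- Coassociativity: both sides are `f(x₁) x₂ g(x₃)`. -/
theorem leftSlice_rightSlice (f g : Module.Dual K C) (x : C) :
    leftSlice f (rightSlice g x) = rightSlice g (leftSlice f x) := by
  have h : leftSlice f ∘ₗ rightSlice g = rightSlice g ∘ₗ leftSlice f := by
    -- The pattern of most Sweedler computations in this proof: each side is written as a linear
    -- function of an arbitrary tensor `z`, checked on pure tensors, and the two expressions are
    -- joined by coassociativity at `z = Δ(x)`.
    have h1 : ∀ z : C ⊗[K] C, leftSlice f (TensorProduct.rid K C (g.lTensor C z)) =
        TensorProduct.rid K C (g.lTensor C (TensorProduct.lid K _ (f.rTensor (C ⊗[K] C)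
          (TensorProduct.assoc K C C C (comul.rTensor C z))))) := by
      intro z
      induction z with
      | zero => simp
      | add x y hx hy => simp only [map_add, hx, hy]
      | tmul a b =>
        simp only [leftSlice, LinearMap.comp_apply, LinearEquiv.coe_coe, LinearMap.lTensor_tmul,
          LinearMap.rTensor_tmul, TensorProduct.rid_tmul, map_smul]
        generalize (comul (R := K) a) = w
        induction w with
        | zero => simp
        | add x y hx hy => simp only [TensorProduct.add_tmul, map_add, smul_add, hx, hy]
        | tmul p q => simpa using smul_comm _ _ _
    have h2 : ∀ z : C ⊗[K] C, rightSlice g (TensorProduct.lid K C (f.rTensor C z)) =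
        TensorProduct.rid K C (g.lTensor C (TensorProduct.lid K _ (f.rTensor (C ⊗[K] C)
          (comul.lTensor C z)))) := by
      intro z
      induction z with
      | zero => simp
      | add x y hx hy => simp only [map_add, hx, hy]
      | tmul a b => simp [rightSlice]
    ext x
    exact (h1 _).trans ((congrArg _ (congrArg _ (congrArg _ (congrArg _
      (coassoc_apply x))))).trans (h2 _).symm)
  exact LinearMap.congr_fun h x

/-- Coassociativity again: slices compose by convolution of functionals, so the vectors `f(x₁) x₂`
for fixed `x` form a left coideal. -/
theorem leftSlice_leftSlice (f g : Module.Dual K C) (x : C) :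
    leftSlice f (leftSlice g x) =
      leftSlice (LinearMap.mul' K K ∘ₗ TensorProduct.map g f ∘ₗ comul) x := by
  have h1 : ∀ z : C ⊗[K] C, leftSlice f (TensorProduct.lid K C (g.rTensor C z)) =
      TensorProduct.lid K _ (f.rTensor C (TensorProduct.lid K _ (g.rTensor (C ⊗[K] C)
        (comul.lTensor C z)))) := by
    intro z
    induction z with
    | zero => simp
    | add x y hx hy => simp only [map_add, hx, hy]
    | tmul a b => simp [leftSlice]
  have h2 : ∀ z : C ⊗[K] C, TensorProduct.lid K C
      ((LinearMap.mul' K K ∘ₗ TensorProduct.map g f ∘ₗ comul).rTensor C z) =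
      TensorProduct.lid K _ (f.rTensor C (TensorProduct.lid K _ (g.rTensor (C ⊗[K] C)
        (TensorProduct.assoc K C C C (comul.rTensor C z))))) := by
    intro z
    induction z with
    | zero => simp
    | add x y hx hy => simp only [map_add, hx, hy]
    | tmul a b =>
      simp only [LinearMap.comp_apply, LinearMap.rTensor_tmul]
      generalize (comul (R := K) a) = w
      induction w with
      | zero => simp
      | add x y hx hy => simp only [TensorProduct.add_tmul, map_add, hx, hy]
      | tmul p q => simp [smul_smul]
  exact (h1 _).trans ((congrArg _ (congrArg _ (congrArg _ (congrArg _
      (coassoc_apply x).symm)))).trans (h2 _).symm)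

theorem rightSlice_rightSlice (f g : Module.Dual K C) (x : C) :
    rightSlice f (rightSlice g x) =
      rightSlice (LinearMap.mul' K K ∘ₗ TensorProduct.map f g ∘ₗ comul) x := by
  have h1 : ∀ z : C ⊗[K] C, rightSlice f (TensorProduct.rid K C (g.lTensor C z)) =
      TensorProduct.rid K _ (f.lTensor C (TensorProduct.rid K _ (g.lTensor (C ⊗[K] C)
        (comul.rTensor C z)))) := by
    intro z
    induction z with
    | zero => simp
    | add x y hx hy => simp only [map_add, hx, hy]
    | tmul a b => simp [rightSlice]
  have h2 : ∀ z : C ⊗[K] C, TensorProduct.rid K C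
      ((LinearMap.mul' K K ∘ₗ TensorProduct.map f g ∘ₗ comul).lTensor C z) =
      TensorProduct.rid K _ (f.lTensor C (TensorProduct.rid K _ (g.lTensor (C ⊗[K] C)
        ((TensorProduct.assoc K C C C).symm (comul.lTensor C z))))) := by
    intro z
    induction z with
    | zero => simp
    | add x y hx hy => simp only [map_add, hx, hy]
    | tmul a b =>
      simp only [LinearMap.comp_apply, LinearMap.lTensor_tmul]
      generalize (comul (R := K) b) = w
      induction w with
      | zero => simp
      | add x y hx hy => simp only [TensorProduct.tmul_add, map_add, hx, hy]
      | tmul p q => simp [smul_smul, mul_comm]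
  exact (h1 _).trans ((congrArg _ (congrArg _ (congrArg _ (congrArg _
      (coassoc_symm_apply x).symm)))).trans (h2 _).symm)

@[simp] theorem leftSlice_counit (x : C) : leftSlice (counit (R := K)) x = x := by
  simp [leftSlice]

@[simp] theorem rightSlice_counit (x : C) : rightSlice (counit (R := K)) x = x := by
  simp [rightSlice]

/-- Both sides are `f(x₁) g(x₂)`. -/
theorem apply_leftSlice (f g : Module.Dual K C) (x : C) :
    g (leftSlice f x) = f (rightSlice g x) := by
  simp only [leftSlice, rightSlice, LinearMap.comp_apply, LinearEquiv.coe_coe]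
  generalize (comul (R := K) x) = w
  induction w with
  | zero => simp
  | add x y hx hy => simp only [map_add, hx, hy]
  | tmul p q => simp [mul_comm]

/-- The coordinate functionals of a basis of `N` already separate tensors. -/
theorem eq_zero_of_forall_lTensor_dual {M N : Type*} [AddCommGroup M] [Module K M] [AddCommGroup N]
    [Module K N] (z : M ⊗[K] N)
    (h : ∀ f : Module.Dual K N, TensorProduct.rid K M (f.lTensor M z) = 0) : z = 0 := by
  classical
  let b := Module.Basis.ofVectorSpace K N
  let e := TensorProduct.equivFinsuppOfBasisRight (M := M) b
  apply e.injective
  rw [map_zero]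
  ext i
  refine Eq.trans ?_ (h (b.coord i))
  clear h
  induction z with
  | zero => simp
  | add x y hx hy => simp only [map_add, Finsupp.add_apply, hx, hy]
  | tmul p q => simp [e]

theorem eq_zero_of_forall_rTensor_dual {M N : Type*} [AddCommGroup M] [Module K M] [AddCommGroup N]
    [Module K N] (z : M ⊗[K] N)
    (h : ∀ f : Module.Dual K M, TensorProduct.lid K N (f.rTensor N z) = 0) : z = 0 := by
  apply (TensorProduct.comm K M N).injective
  rw [map_zero]
  refine eq_zero_of_forall_lTensor_dual _ fun f => ?_
  rw [← h f]
  clear h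
  induction z with
  | zero => simp
  | add x y hx hy => simp only [map_add, hx, hy]
  | tmul p q => simp

theorem exists_finiteDimensional_slices {M N : Type*} [AddCommGroup M] [Module K M]
    [AddCommGroup N] [Module K N] (z : M ⊗[K] N) : ∃ F : Submodule K N, FiniteDimensional K F ∧
      ∀ f : Module.Dual K M, TensorProduct.lid K N (f.rTensor N z) ∈ F := by
  induction z with
  | zero => exact ⟨⊥, inferInstance, by simp⟩
  | add x y hx hy =>
    obtain ⟨F, _, hF⟩ := hx
    obtain ⟨G, _, hG⟩ := hy
    refine ⟨F ⊔ G, inferInstance, fun f => ?_⟩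
    rw [map_add, map_add]
    exact add_mem (Submodule.mem_sup_left (hF f)) (Submodule.mem_sup_right (hG f))
  | tmul p q =>
    refine ⟨K ∙ q, inferInstance, fun f => ?_⟩
    simpa using Submodule.smul_mem _ _ (Submodule.mem_span_singleton_self q)

end Slices

/-! ### Wedges of subspaces and wedge powers -/

section Wedge

variable {K : Type u} {C : Type v} [Field K] [AddCommGroup C] [Module K C]

/-- Over a field `D ⊗ F` is the intersection of `D ⊗ N` and `M ⊗ F`, and functionals detect
membership in each of the two. -/
theorem mem_range_map_subtype_of_slices {M N : Type*} [AddCommGroup M] [Module K M]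
    [AddCommGroup N] [Module K N] (D : Submodule K M) (F : Submodule K N) (z : M ⊗[K] N)
    (h1 : ∀ f : Module.Dual K N, TensorProduct.rid K M (f.lTensor M z) ∈ D)
    (h2 : ∀ f : Module.Dual K M, TensorProduct.lid K N (f.rTensor N z) ∈ F) :
    z ∈ LinearMap.range (TensorProduct.map D.subtype F.subtype) := by
  have e1 : D.mkQ.rTensor N z = 0 := by
    refine eq_zero_of_forall_lTensor_dual _ fun f => ?_
    have : TensorProduct.rid K _ (f.lTensor _ (D.mkQ.rTensor N z)) =
        D.mkQ (TensorProduct.rid K M (f.lTensor M z)) := by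
      clear h1 h2
      induction z with
      | zero => simp
      | add x y hx hy => simp only [map_add, hx, hy]
      | tmul p q => simp
    rw [this]
    simpa using h1 f
  have e2 : F.mkQ.lTensor M z = 0 := by
    refine eq_zero_of_forall_rTensor_dual _ fun f => ?_
    have : TensorProduct.lid K _ (f.rTensor _ (F.mkQ.lTensor M z)) =
        F.mkQ (TensorProduct.lid K N (f.rTensor N z)) := by
      clear h1 h2 e1
      induction z with
      | zero => simp
      | add x y hx hy => simp only [map_add, hx, hy]
      | tmul p q => simp
    rw [this]
    simpa using h2 f
  -- Right exactness lifts `z` to `D ⊗ N`; flatness shows that the lift still dies in `D ⊗ (N / F)`,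
  -- so it lifts further to `D ⊗ F`.
  rw [← LinearMap.mem_ker, rTensor_mkQ] at e1
  obtain ⟨w, rfl⟩ := e1
  have e3 : D.subtype.rTensor _ (F.mkQ.lTensor D w) = 0 := by
    rw [← e2, ← LinearMap.comp_apply, ← LinearMap.comp_apply, LinearMap.rTensor_comp_lTensor,
      LinearMap.lTensor_comp_rTensor]
  have e4 : F.mkQ.lTensor D w = 0 :=
    Module.Flat.rTensor_preserves_injective_linearMap D.subtype D.subtype_injective
      (by rw [e3, map_zero])
  rw [← LinearMap.mem_ker, lTensor_mkQ] at e4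
  obtain ⟨w', rfl⟩ := e4
  refine ⟨w', ?_⟩
  rw [← LinearMap.comp_apply, LinearMap.rTensor_comp_lTensor]

/-- The subspace `D ⊗ C + C ⊗ F` of `C ⊗ C`. -/
def wedgeTensor (D F : Submodule K C) : Submodule K (C ⊗[K] C) :=
  LinearMap.range (D.subtype.rTensor C) ⊔ LinearMap.range (F.subtype.lTensor C)

theorem wedgeTensor_induction {D F : Submodule K C} {p : C ⊗[K] C → Prop}
    (add : ∀ x y, p x → p y → p (x + y)) (zero : p 0) (left : ∀ d ∈ D, ∀ c, p (d ⊗ₜ c))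
    (right : ∀ c, ∀ d ∈ F, p (c ⊗ₜ d)) {z : C ⊗[K] C} (hz : z ∈ wedgeTensor D F) : p z := by
  obtain ⟨_, ⟨x, rfl⟩, _, ⟨y, rfl⟩, rfl⟩ := Submodule.mem_sup.mp hz
  clear hz
  apply add
  · induction x with
    | zero => simpa using zero
    | add x y hx hy => rw [map_add]; exact add _ _ hx hy
    | tmul a b => exact left _ a.2 _
  · induction y with
    | zero => simpa using zero
    | add x y hx hy => rw [map_add]; exact add _ _ hx hy
    | tmul a b => exact right _ _ b.2

theorem tmul_mem_wedgeTensor_left {D : Submodule K C} (F : Submodule K C) {d : C} (hd : d ∈ D)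
    (c : C) : d ⊗ₜ c ∈ wedgeTensor D F :=
  Submodule.mem_sup_left ⟨(⟨d, hd⟩ : D) ⊗ₜ c, rfl⟩

theorem tmul_mem_wedgeTensor_right (D : Submodule K C) {F : Submodule K C} (c : C) {d : C}
    (hd : d ∈ F) : c ⊗ₜ d ∈ wedgeTensor D F :=
  Submodule.mem_sup_right ⟨c ⊗ₜ (⟨d, hd⟩ : F), rfl⟩

theorem wedgeTensor_mono {D D' F F' : Submodule K C} (hD : D ≤ D') (hF : F ≤ F') :
    wedgeTensor D F ≤ wedgeTensor D' F' := fun _ hz =>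
  wedgeTensor_induction (p := (· ∈ wedgeTensor D' F')) (fun _ _ => add_mem) (zero_mem _)
    (fun _ hd _ => tmul_mem_wedgeTensor_left _ (hD hd) _)
    (fun _ _ hd => tmul_mem_wedgeTensor_right _ _ (hF hd)) hz

/-- `D ⊗ C + C ⊗ F` is the kernel of `C ⊗ C → C/D ⊗ C/F`, and functionals on `C/F` are those on `C`
that vanish on `F`. -/
theorem mem_wedgeTensor_iff (D F : Submodule K C) (z : C ⊗[K] C) :
    z ∈ wedgeTensor D F ↔ ∀ f : Module.Dual K C, (∀ y ∈ F, f y = 0) →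
      TensorProduct.rid K C (f.lTensor C z) ∈ D := by
  constructor
  · intro hz f hf
    refine wedgeTensor_induction (p := fun z => TensorProduct.rid K C (f.lTensor C z) ∈ D)
      ?_ ?_ ?_ ?_ hz
    · intro x y hx hy
      rw [map_add, map_add]
      exact add_mem hx hy
    · simp
    · intro d hd c
      simpa using D.smul_mem _ hd
    · intro c d hd
      simp [hf d hd]
  · intro h
    have hk : TensorProduct.map D.mkQ F.mkQ z = 0 := by
      refine eq_zero_of_forall_lTensor_dual _ fun f => ?_
      have : TensorProduct.rid K _ (f.lTensor _ (TensorProduct.map D.mkQ F.mkQ z)) =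
          D.mkQ (TensorProduct.rid K C ((f ∘ₗ F.mkQ).lTensor C z)) := by
        clear h
        induction z with
        | zero => simp
        | add x y hx hy => simp only [map_add, hx, hy]
        | tmul p q => simp
      rw [this]
      simpa using h (f ∘ₗ F.mkQ) (fun y hy => by simp [(Submodule.Quotient.mk_eq_zero F).mpr hy])
    rw [← LinearMap.mem_ker, TensorProduct.map_ker (LinearMap.exact_subtype_mkQ D)
      D.mkQ_surjective (LinearMap.exact_subtype_mkQ F) F.mkQ_surjective, sup_comm] at hk
    exact hk

variable [Coalgebra K C]

/-- The wedge of two subspaces of a coalgebra: the inverse image under `Δ` of `D ⊗ C + C ⊗ F`. -/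
def wedge (D F : Submodule K C) : Submodule K C :=
  (wedgeTensor D F).comap comul

theorem mem_wedge {D F : Submodule K C} {x : C} :
    x ∈ wedge D F ↔ comul (R := K) x ∈ wedgeTensor D F := Iff.rfl

theorem mem_wedge_iff {D F : Submodule K C} {x : C} :
    x ∈ wedge D F ↔ ∀ f : Module.Dual K C, (∀ y ∈ F, f y = 0) → rightSlice f x ∈ D :=
  mem_wedgeTensor_iff D F _

theorem IsSubcoalgebra.leftSlice_mem {D : Submodule K C} (hD : IsSubcoalgebra K D)
    (f : Module.Dual K C) {x : C} (hx : x ∈ D) : leftSlice f x ∈ D := by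
  obtain ⟨z, hz⟩ := hD x hx
  simp only [leftSlice, LinearMap.comp_apply, LinearEquiv.coe_coe, ← hz]
  clear hz
  induction z with
  | zero => simp
  | add x y hx hy => simp only [map_add]; exact add_mem hx hy
  | tmul a b => simpa using D.smul_mem _ b.2

theorem IsSubcoalgebra.rightSlice_mem {D : Submodule K C} (hD : IsSubcoalgebra K D)
    (f : Module.Dual K C) {x : C} (hx : x ∈ D) : rightSlice f x ∈ D := by
  obtain ⟨z, hz⟩ := hD x hx
  simp only [rightSlice, LinearMap.comp_apply, LinearEquiv.coe_coe, ← hz]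
  clear hz
  induction z with
  | zero => simp
  | add x y hx hy => simp only [map_add]; exact add_mem hx hy
  | tmul a b => simpa using D.smul_mem _ a.2

theorem isSubcoalgebra_of_slices {D : Submodule K C}
    (h1 : ∀ (f : Module.Dual K C), ∀ x ∈ D, leftSlice f x ∈ D)
    (h2 : ∀ (f : Module.Dual K C), ∀ x ∈ D, rightSlice f x ∈ D) : IsSubcoalgebra K D :=
  fun x hx => mem_range_map_subtype_of_slices D D _ (fun f => h2 f x hx) (fun f => h1 f x hx)

/-- The wedge powers `H, H ∧ H, H ∧ (H ∧ H), …` of a subspace of a coalgebra. -/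
def wedgePow (H : Submodule K C) : ℕ → Submodule K C
  | 0 => H
  | n + 1 => wedge H (wedgePow H n)

theorem wedgePow_le_succ {H : Submodule K C} (hH : IsSubcoalgebra K H) (n : ℕ) :
    wedgePow H n ≤ wedgePow H (n + 1) := by
  induction n with
  | zero => exact fun x hx => mem_wedge_iff.mpr fun f _ => IsSubcoalgebra.rightSlice_mem hH f hx
  | succ n ih => exact fun x hx => wedgeTensor_mono le_rfl ih hx

theorem wedgePow_mono {H : Submodule K C} (hH : IsSubcoalgebra K H) : Monotone (wedgePow H) :=
  monotone_nat_of_le_succ (wedgePow_le_succ hH)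

/-- Left slices commute with the right slices that define the wedge, and they preserve its left
factor `H`. The right factor plays no role, so no induction is needed. -/
theorem leftSlice_mem_wedgePow {H : Submodule K C} (hH : IsSubcoalgebra K H) (n : ℕ)
    (f : Module.Dual K C) {x : C} (hx : x ∈ wedgePow H n) : leftSlice f x ∈ wedgePow H n := by
  cases n with
  | zero => exact IsSubcoalgebra.leftSlice_mem hH f hx
  | succ n =>
    refine mem_wedge_iff.mpr fun g hg => ?_
    rw [← leftSlice_rightSlice]
    exact IsSubcoalgebra.leftSlice_mem hH f (mem_wedge_iff.mp hx g hg)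

/-- Puts the second leg of `Δ(x)` in `F`; this is how the corrections are later seen to vanish on
layers already treated. -/
theorem comul_mem_range_lTensor_of_leftSlice {F : Submodule K C} {x : C}
    (h : ∀ f : Module.Dual K C, leftSlice f x ∈ F) :
    comul (R := K) x ∈ LinearMap.range (F.subtype.lTensor C) := by
  obtain ⟨z, hz⟩ := mem_range_map_subtype_of_slices ⊤ F (comul (R := K) x)
    (fun _ => Submodule.mem_top) h
  refine ⟨(⊤ : Submodule K C).subtype.rTensor F z, ?_⟩
  rw [← hz, ← LinearMap.comp_apply, LinearMap.lTensor_comp_rTensor]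

end Wedge

/-! ### Simple left coideals and exhaustion by wedge powers -/

section Coradical

variable {K : Type u} {C : Type v} [Field K] [AddCommGroup C] [Module K C] [Coalgebra K C]

variable (K C) in
/-- The algebra of endomorphisms of `C` generated by the maps `x ↦ f(x₁) x₂`. Its submodules are
the left coideals of `C`. -/
def sliceAlgebra : Subalgebra K (Module.End K C) :=
  Algebra.adjoin K (Set.range (leftSlice (K := K) (C := C)))

/-- The map `x ↦ f(x₁) x₂` as an element of `sliceAlgebra`. -/
def sliceElem (f : Module.Dual K C) : sliceAlgebra K C :=
  ⟨leftSlice f, Algebra.subset_adjoin ⟨f, rfl⟩⟩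

/-- A left coideal as a submodule over `sliceAlgebra`. -/
def coidealSubmodule (D : Submodule K C)
    (h : ∀ (f : Module.Dual K C), ∀ x ∈ D, leftSlice f x ∈ D) :
    Submodule (sliceAlgebra K C) C where
  __ := D.toAddSubmonoid
  smul_mem' := by
    rintro ⟨r, hr⟩ x hx
    change r x ∈ D
    change x ∈ D at hx
    induction hr using Algebra.adjoin_induction generalizing x with
    | mem r hr =>
      obtain ⟨f, rfl⟩ := hr
      exact h f x hx
    | algebraMap r => exact D.smul_mem r hx
    | add r s _ _ hr hs => exact add_mem (hr hx) (hs hx)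
    | mul r s _ _ hr hs => exact hr (hs hx)

/-- The map `x ↦ x₁ f(x₂)` is linear over `sliceAlgebra`. -/
def rightSliceHom (f : Module.Dual K C) : C →ₗ[sliceAlgebra K C] C where
  __ := (rightSlice f).toAddHom
  map_smul' := by
    rintro ⟨r, hr⟩ x
    change rightSlice f (r x) = r (rightSlice f x)
    induction hr using Algebra.adjoin_induction generalizing x with
    | mem r hr =>
      obtain ⟨g, rfl⟩ := hr
      exact (leftSlice_rightSlice g f x).symm
    | algebraMap r => exact map_smul _ _ _
    | add r s _ _ hr hs => rw [LinearMap.add_apply, map_add, hr, hs, LinearMap.add_apply]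
    | mul r s _ _ hr hs => rw [Module.End.mul_apply, hr, hs, Module.End.mul_apply]

theorem rightSliceHom_apply (f : Module.Dual K C) (x : C) :
    rightSliceHom f x = rightSlice f x := rfl

/-- Every element of a coalgebra lies in a finite-dimensional left coideal. -/
theorem exists_finiteDimensional_coideal (x : C) : ∃ N : Submodule (sliceAlgebra K C) C,
    x ∈ N ∧ FiniteDimensional K (N.restrictScalars K) := by
  -- The coideal consists of all `f(x₁) x₂`; taking `f = ε` shows that it contains `x`, and it is
  -- finite-dimensional because `Δ(x)` is a finite sum.
  let ev : Module.Dual K C →ₗ[K] C :=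
    { toFun := fun f => leftSlice f x
      map_add' := fun f g => by simp [leftSlice, LinearMap.rTensor_add]
      map_smul' := fun c f => by simp [leftSlice, LinearMap.rTensor_smul] }
  refine ⟨coidealSubmodule (LinearMap.range ev) ?_, ⟨counit, leftSlice_counit x⟩, ?_⟩
  · rintro f _ ⟨g, rfl⟩
    exact ⟨_, (leftSlice_leftSlice f g x).symm⟩
  · obtain ⟨F, _, hF⟩ := exists_finiteDimensional_slices (comul (R := K) x)
    refine Submodule.finiteDimensional_of_le (S₂ := F) ?_
    rintro _ ⟨g, rfl⟩
    exact hF g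

theorem exists_isSimpleModule_of_isArtinian {R M : Type*} [Ring R] [AddCommGroup M] [Module R M]
    (N : Submodule R M) [IsArtinian R N] (hN : N ≠ ⊥) :
    ∃ T ≤ N, IsSimpleModule R T := by
  obtain h | ⟨T, hT, -⟩ := IsAtomic.eq_bot_or_exists_atom_le (⊤ : Submodule R N)
  · refine absurd ?_ hN
    rw [← Submodule.subsingleton_iff_eq_bot]
    exact (Submodule.subsingleton_iff R).mp (subsingleton_of_bot_eq_top h.symm)
  · have := isSimpleModule_iff_isAtom.mpr hT
    exact ⟨T.map N.subtype, Submodule.map_subtype_le _ _,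
      IsSimpleModule.congr (Submodule.equivMapOfInjective _ N.subtype_injective T).symm⟩

theorem isArtinian_of_finiteDimensional_restrictScalars (N : Submodule (sliceAlgebra K C) C)
    [h : FiniteDimensional K (N.restrictScalars K)] : IsArtinian (sliceAlgebra K C) N :=
  haveI : IsArtinian K N := inferInstanceAs (IsArtinian K (N.restrictScalars K))
  isArtinian_of_tower K inferInstance

/-- A simple left coideal is contained in the coradical. -/
theorem le_corad_of_isSimpleModule (T : Submodule (sliceAlgebra K C) C)
    [IsSimpleModule (sliceAlgebra K C) T] : T.restrictScalars K ≤ Corad K C := by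
  -- The subcoalgebra generated by `T`. As a sum of images of `T` under module endomorphisms it is
  -- isotypic of type `T`; it turns out to be simple.
  let c : Submodule (sliceAlgebra K C) C := ⨆ g, T.map (rightSliceHom g)
  have hTc : T ≤ c := fun t ht =>
    Submodule.mem_iSup_of_mem counit ⟨t, ht, rightSlice_counit t⟩
  have hc_iso : c ≤ isotypicComponent (sliceAlgebra K C) C T :=
    iSup_le fun g => Submodule.map_le_isotypicComponent T _
  have hright : ∀ (f : Module.Dual K C), ∀ x ∈ c, rightSlice f x ∈ c := by
    intro f x hx
    have : c.map (rightSliceHom f) ≤ c := by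
      rw [Submodule.map_iSup]
      refine iSup_le fun g => ?_
      rintro _ ⟨_, ⟨t, ht, rfl⟩, rfl⟩
      exact Submodule.mem_iSup_of_mem _ ⟨t, ht, (rightSlice_rightSlice f g t).symm⟩
    exact this ⟨x, hx, rfl⟩
  have hsub : IsSubcoalgebra K (c.restrictScalars K) :=
    isSubcoalgebra_of_slices (fun f x hx => c.smul_mem (sliceElem f) hx) hright
  have hle : ∀ D : Submodule K C, IsSubcoalgebra K D → D ≤ c.restrictScalars K → D ≠ ⊥ →
      c.restrictScalars K ≤ D := by
    intro D hD hDc hne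
    let D' := coidealSubmodule D fun f x hx => IsSubcoalgebra.leftSlice_mem hD f hx
    obtain ⟨x, hx, hx0⟩ := D.exists_mem_ne_zero_of_ne_bot hne
    -- Cutting `D` with a finite-dimensional coideal gives an artinian module, hence a simple left
    -- coideal `T'` inside `D`, which is isomorphic to `T` by isotypicity.
    obtain ⟨N, hxN, hN⟩ := exists_finiteDimensional_coideal (K := K) x
    have : FiniteDimensional K ((N ⊓ D').restrictScalars K) :=
      Submodule.finiteDimensional_of_le (S₂ := N.restrictScalars K) fun y hy => hy.1
    have := isArtinian_of_finiteDimensional_restrictScalars (N ⊓ D')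
    obtain ⟨T', hT', _⟩ := exists_isSimpleModule_of_isArtinian (N ⊓ D')
      ((Submodule.ne_bot_iff _).mpr ⟨x, ⟨hxN, hx⟩, hx0⟩)
    have hT'D : T' ≤ D' := hT'.trans inf_le_right
    obtain ⟨e⟩ := isIsotypicOfType_submodule_iff.mp
      (IsIsotypicOfType.isotypicComponent (sliceAlgebra K C) C T) T'
      (le_trans (fun y hy => hDc (hT'D hy)) hc_iso)
    -- A colinear map into `C` is determined by its composite with `ε`. Extending `ε ∘ e` to a
    -- functional `g` on `C` therefore realises `e` as a right slice; the subcoalgebra `D` is stable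
    -- under right slices, so `T = e(T')` lies in `D`.
    let l : T'.restrictScalars K →ₗ[K] K :=
      counit ∘ₗ (T.restrictScalars K).subtype ∘ₗ (e.toLinearMap.restrictScalars K)
    obtain ⟨g, hg⟩ := LinearMap.exists_extend l
    have key : ∀ t : T', rightSlice g (t : C) = (e t : C) := by
      intro t
      rw [← sub_eq_zero, ← Module.forall_dual_apply_eq_zero_iff K]
      intro f
      have h1 : g (leftSlice f (t : C)) = counit (R := K) (leftSlice f (e t : C)) := by
        have := LinearMap.congr_fun hg (sliceElem f • t)
        refine Eq.trans this ?_
        change counit (R := K) ((e (sliceElem f • t) : T) : C) = _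
        rw [map_smul]
        rfl
      rw [map_sub, ← apply_leftSlice, h1, apply_leftSlice, rightSlice_counit, sub_self]
    have hTD : T ≤ D' := by
      intro t ht
      obtain ⟨t', ht'⟩ := e.surjective ⟨t, ht⟩
      have := key t'
      rw [ht'] at this
      rw [show t = _ from this.symm]
      exact IsSubcoalgebra.rightSlice_mem hD g (hT'D t'.2)
    have : c ≤ D' := by
      refine iSup_le fun g => ?_
      rintro _ ⟨t, ht, rfl⟩
      exact IsSubcoalgebra.rightSlice_mem hD g (hTD ht)
    exact this
  have hsimple : IsSimpleSubcoalgebra K (c.restrictScalars K) := by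
    refine ⟨hsub, ?_, fun D hD hDc => ?_⟩
    · have := IsSimpleModule.nontrivial (sliceAlgebra K C) T
      obtain ⟨t, ht⟩ := exists_ne (0 : T)
      exact (Submodule.ne_bot_iff _).mpr ⟨t, hTc t.2, fun h => ht (Subtype.ext h)⟩
    · by_cases h : D = ⊥
      · exact Or.inl h
      · exact Or.inr (le_antisymm hDc (hle D hD hDc h))
  exact le_trans (fun t ht => hTc ht) (le_sSup hsimple)

/-- If a subcoalgebra `H` contains the coradical, then its wedge powers exhaust the coalgebra. -/
theorem exists_mem_wedgePow {H : Submodule K C} (hH : IsSubcoalgebra K H)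
    (hcorad : Corad K C ≤ H) (x : C) : ∃ n, x ∈ wedgePow H n := by
  have hdir : Directed (· ≤ ·) (wedgePow H) := (wedgePow_mono hH).directed_le
  let F : Submodule (sliceAlgebra K C) C := coidealSubmodule (⨆ n, wedgePow H n) (by
    intro f x hx
    obtain ⟨n, hn⟩ := (Submodule.mem_iSup_of_directed _ hdir).mp hx
    exact Submodule.mem_iSup_of_mem n (leftSlice_mem_wedgePow hH n f hn))
  suffices hF : x ∈ F from (Submodule.mem_iSup_of_directed _ hdir).mp hF
  by_contra hx
  -- If `x` is not in `F`, a finite-dimensional coideal containing it has nonzero artinian image in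
  -- `C/F`, which contains a simple `W`. The contradiction will be that a representative `y` of a
  -- nonzero class in `W` lies in `F`.
  obtain ⟨N, hxN, hN⟩ := exists_finiteDimensional_coideal (K := K) x
  have := isArtinian_of_finiteDimensional_restrictScalars N
  have : IsArtinian (sliceAlgebra K C) (N.map F.mkQ) :=
    isArtinian_of_surjective _ (F.mkQ.submoduleMap N) (F.mkQ.submoduleMap_surjective N)
  obtain ⟨W, -, _⟩ := exists_isSimpleModule_of_isArtinian (N.map F.mkQ)
    ((Submodule.ne_bot_iff _).mpr ⟨F.mkQ x, ⟨x, hxN, rfl⟩,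
      fun h => hx ((Submodule.Quotient.mk_eq_zero F).mp h)⟩)
  have := IsSimpleModule.nontrivial (sliceAlgebra K C) W
  obtain ⟨⟨w, hw⟩, hw0⟩ := exists_ne (0 : W)
  obtain ⟨y, rfl⟩ := F.mkQ_surjective w
  refine hw0 (Subtype.ext ((Submodule.Quotient.mk_eq_zero F).mpr ?_))
  have hy : ∀ f : Module.Dual K C, (∀ z ∈ (⨆ n, wedgePow H n), f z = 0) →
      rightSlice f y ∈ H := by
    intro f hf
    -- `F` is a left coideal killed by `f`, so `g(z₁) f(z₂) = f(g(z₁) z₂) = 0` for every functional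
    -- `g`; the right slice descends to `C/F`.
    have hker : F ≤ LinearMap.ker (rightSliceHom f) := by
      intro z hz
      obtain ⟨n, hn⟩ := (Submodule.mem_iSup_of_directed _ hdir).mp hz
      rw [LinearMap.mem_ker, rightSliceHom_apply,
        ← Module.forall_dual_apply_eq_zero_iff K]
      intro g
      rw [← apply_leftSlice]
      exact hf _ (Submodule.mem_iSup_of_mem n (leftSlice_mem_wedgePow hH n g hn))
    let φ := F.liftQ (rightSliceHom f) hker
    have hφ : rightSlice f y ∈ LinearMap.range (φ ∘ₗ W.subtype) := ⟨⟨F.mkQ y, hw⟩, rfl⟩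
    -- Schur: the image of `W` is a simple left coideal, hence in the coradical, or it is zero.
    obtain h | h := LinearMap.injective_or_eq_zero (φ ∘ₗ W.subtype)
    · have : IsSimpleModule (sliceAlgebra K C) (LinearMap.range (φ ∘ₗ W.subtype)) :=
        IsSimpleModule.congr (LinearEquiv.ofInjective _ h).symm
      exact hcorad (le_corad_of_isSimpleModule (LinearMap.range (φ ∘ₗ W.subtype)) hφ)
    · have : rightSlice f y = 0 := LinearMap.congr_fun h ⟨F.mkQ y, hw⟩
      rw [this]
      exact zero_mem _
  have hy' : comul (R := K) y ∈ wedgeTensor H (⨆ n, wedgePow H n) := mem_wedge_iff.mpr hy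
  -- Only finitely many terms occur in `Δ(y)`, so a single wedge power serves for all of them.
  obtain ⟨n, hn⟩ : ∃ n, comul (R := K) y ∈ wedgeTensor H (wedgePow H n) := by
    refine wedgeTensor_induction (p := fun z => ∃ n, z ∈ wedgeTensor H (wedgePow H n))
      ?_ ⟨0, zero_mem _⟩ ?_ ?_ hy'
    · rintro a b ⟨m, hm⟩ ⟨n, hn⟩
      exact ⟨max m n, add_mem
        (wedgeTensor_mono le_rfl (wedgePow_mono hH (le_max_left m n)) hm)
        (wedgeTensor_mono le_rfl (wedgePow_mono hH (le_max_right m n)) hn)⟩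
    · exact fun d hd c => ⟨0, tmul_mem_wedgeTensor_left _ hd c⟩
    · intro c d hd
      obtain ⟨n, hn⟩ := (Submodule.mem_iSup_of_directed _ hdir).mp hd
      exact ⟨n, tmul_mem_wedgeTensor_right _ c hn⟩
  exact Submodule.mem_iSup_of_mem (n + 1) hn

end Coradical

/-! ### The universal coderivation and formal smoothness -/

namespace Bicomodule

variable {K : Type u} {C : Type v} [Field K] [AddCommGroup C] [Module K C] [Coalgebra K C]
  {M : Type v} [AddCommGroup M] [Module K M]

/-- The bicomodule `C ⊗ M`, with coactions `Δ ⊗ M` and `C ⊗ ρ`, where `ρ` is the right coaction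
of the bicomodule `M`. -/
@[simps coactL coactR]
def tensorLeft (X : Bicomodule K C M) : Bicomodule K C (C ⊗[K] M) where
  coactL := TensorProduct.assoc K C C M ∘ₗ comul.rTensor M
  coactR := (TensorProduct.assoc K C M C).symm ∘ₗ X.coactR.lTensor C
  coassocL := by
    refine TensorProduct.ext' fun c d => ?_
    let φ : (C ⊗[K] C) →ₗ[K] C ⊗[K] (C ⊗[K] M) :=
      (TensorProduct.assoc K C C M).toLinearMap ∘ₗ (TensorProduct.mk K (C ⊗[K] C) M).flip d
    have h1 : ∀ z : C ⊗[K] C, TensorProduct.assoc K C C (C ⊗[K] M)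
        ((comul (R := K)).rTensor (C ⊗[K] M) (TensorProduct.assoc K C C M (z ⊗ₜ d))) =
        φ.lTensor C (TensorProduct.assoc K C C C ((comul (R := K)).rTensor C z)) := by
      intro z
      induction z with
      | zero => simp
      | add x y hx hy => simp only [TensorProduct.add_tmul, map_add, hx, hy]
      | tmul a b =>
        simp only [LinearMap.rTensor_tmul, TensorProduct.assoc_tmul]
        generalize (comul (R := K) a) = w
        induction w with
        | zero => simp
        | add x y hx hy => simp only [TensorProduct.add_tmul, map_add, hx, hy]
        | tmul p q => rfl
    have h2 : ∀ z : C ⊗[K] C, ((TensorProduct.assoc K C C M).toLinearMap ∘ₗ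
        (comul (R := K)).rTensor M).lTensor C (TensorProduct.assoc K C C M (z ⊗ₜ d)) =
        φ.lTensor C ((comul (R := K)).lTensor C z) := by
      intro z
      induction z with
      | zero => simp
      | add x y hx hy => simp only [TensorProduct.add_tmul, map_add, hx, hy]
      | tmul a b => rfl
    exact (h1 _).trans ((congrArg _ (coassoc_apply c)).trans (h2 _).symm)
  counitL := by
    refine TensorProduct.ext' fun c d => ?_
    have h1 : ∀ z : C ⊗[K] C, (counit (R := K)).rTensor (C ⊗[K] M)
        (TensorProduct.assoc K C C M (z ⊗ₜ d)) =
        ((TensorProduct.mk K C M).flip d).lTensor K ((counit (R := K)).rTensor C z) := by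
      intro z
      induction z with
      | zero => simp
      | add x y hx hy => simp only [TensorProduct.add_tmul, map_add, hx, hy]
      | tmul a b => rfl
    exact (h1 _).trans (congrArg _ (Coalgebra.rTensor_counit_comul c))
  coassocR := by
    refine TensorProduct.ext' fun c d => ?_
    let φ : M ⊗[K] (C ⊗[K] C) →ₗ[K] (C ⊗[K] M) ⊗[K] (C ⊗[K] C) :=
      (TensorProduct.assoc K C M (C ⊗[K] C)).symm.toLinearMap ∘ₗ
        TensorProduct.mk K C (M ⊗[K] (C ⊗[K] C)) c
    have h1 : ∀ z : M ⊗[K] C, TensorProduct.assoc K (C ⊗[K] M) C C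
        (((TensorProduct.assoc K C M C).symm.toLinearMap ∘ₗ
          X.coactR.lTensor C).rTensor C
            ((TensorProduct.assoc K C M C).symm (c ⊗ₜ z))) =
        φ (TensorProduct.assoc K M C C (X.coactR.rTensor C z)) := by
      intro z
      induction z with
      | zero => simp
      | add x y hx hy => simp only [TensorProduct.tmul_add, map_add, hx, hy]
      | tmul a b =>
        simp only [LinearMap.rTensor_tmul, LinearMap.lTensor_tmul, TensorProduct.assoc_symm_tmul,
          LinearMap.comp_apply, LinearEquiv.coe_coe]
        generalize X.coactR a = w
        induction w with
        | zero => simp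
        | add x y hx hy =>
          simp only [TensorProduct.add_tmul, TensorProduct.tmul_add, map_add, hx, hy]
        | tmul p q => rfl
    have h2 : ∀ z : M ⊗[K] C, (comul (R := K)).lTensor (C ⊗[K] M)
        ((TensorProduct.assoc K C M C).symm (c ⊗ₜ z)) =
        φ ((comul (R := K)).lTensor M z) := by
      intro z
      induction z with
      | zero => simp
      | add x y hx hy => simp only [TensorProduct.tmul_add, map_add, hx, hy]
      | tmul a b => rfl
    exact (h1 _).trans ((congrArg _ (LinearMap.congr_fun X.coassocR d)).trans (h2 _).symm)
  counitR := by
    refine TensorProduct.ext' fun c d => ?_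
    have h1 : ∀ z : M ⊗[K] C, (counit (R := K)).lTensor (C ⊗[K] M)
        ((TensorProduct.assoc K C M C).symm (c ⊗ₜ z)) =
        (TensorProduct.assoc K C M K).symm (c ⊗ₜ (counit (R := K)).lTensor M z) := by
      intro z
      induction z with
      | zero => simp
      | add x y hx hy => simp only [TensorProduct.tmul_add, map_add, hx, hy]
      | tmul a b => rfl
    refine (h1 _).trans ?_
    rw [show counit.lTensor M (X.coactR d) = _ from LinearMap.congr_fun X.counitR d]
    rfl
  coactL_coactR := by
    refine TensorProduct.ext' fun c d => ?_
    have h1 : ∀ z : M ⊗[K] C, TensorProduct.assoc K C (C ⊗[K] M) C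
        (((TensorProduct.assoc K C C M).toLinearMap ∘ₗ
          (comul (R := K)).rTensor M).rTensor C
            ((TensorProduct.assoc K C M C).symm (c ⊗ₜ z))) =
        (TensorProduct.assoc K C M C).symm.toLinearMap.lTensor C
          (TensorProduct.assoc K C C (M ⊗[K] C) (comul (R := K) c ⊗ₜ z)) := by
      intro z
      induction z with
      | zero => simp
      | add x y hx hy => simp only [TensorProduct.tmul_add, map_add, hx, hy]
      | tmul a b =>
        simp only [LinearMap.rTensor_tmul, TensorProduct.assoc_symm_tmul,
          LinearMap.comp_apply, LinearEquiv.coe_coe]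
        generalize (comul (R := K) c) = w
        induction w with
        | zero => simp
        | add x y hx hy => simp only [TensorProduct.add_tmul, map_add, hx, hy]
        | tmul p q => rfl
    have h2 : ∀ z : C ⊗[K] C, ((TensorProduct.assoc K C M C).symm.toLinearMap ∘ₗ
        X.coactR.lTensor C).lTensor C (TensorProduct.assoc K C C M (z ⊗ₜ d)) =
        (TensorProduct.assoc K C M C).symm.toLinearMap.lTensor C
          (TensorProduct.assoc K C C (M ⊗[K] C) (z ⊗ₜ X.coactR d)) := by
      intro z
      induction z with
      | zero => simp
      | add x y hx hy => simp only [TensorProduct.add_tmul, map_add, hx, hy]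
      | tmul a b => rfl
    exact (h1 _).trans (h2 _).symm

theorem isHom_coactL (X : Bicomodule K C M) : IsHom X X.tensorLeft X.coactL where
  left := X.coassocL
  right := by
    rw [tensorLeft_coactR, LinearMap.comp_assoc, ← X.coactL_coactR]
    ext x
    simp

/-- A relatively injective bicomodule is a retract of `C ⊗ I`. -/
theorem IsRelInjective.exists_retraction {I : Type v} [AddCommGroup I] [Module K I]
    {X : Bicomodule K C I} (hX : X.IsRelInjective) :
    ∃ τ : C ⊗[K] I →ₗ[K] I, IsHom X.tensorLeft X τ ∧ τ ∘ₗ X.coactL = LinearMap.id := by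
  refine hX I (C ⊗[K] I) X X.tensorLeft X.coactL (isHom_coactL X) ?_ LinearMap.id ?_
  -- By counitality `ε ⊗ I` is a linear retraction of the coaction, so the identity of `I` extends
  -- along it.
  · refine ⟨TensorProduct.lid K I ∘ₗ counit.rTensor I, ?_⟩
    rw [LinearMap.comp_assoc, X.counitL]
    ext x
    simp
  · exact ⟨by simp, by simp⟩

variable (K C) in
/-- The universal coderivation `℧₁ C → C`, `b ⊗ d ↦ ε(d) b - ε(b) d`. -/
def coderivation : CokerComul K C →ₗ[K] C :=
  Submodule.liftQ _ (TensorProduct.rid K C ∘ₗ counit.lTensor C -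
    TensorProduct.lid K C ∘ₗ counit.rTensor C) (by
      rw [LinearMap.range_le_ker_iff]
      ext x
      simp)

theorem coderivation_mk_tmul (b d : C) : coderivation K C (cokerComulMk K C (b ⊗ₜ d)) =
    counit (R := K) d • b - counit (R := K) b • d := by
  simp [coderivation]

theorem counit_coderivation (v : CokerComul K C) :
    counit (R := K) (coderivation K C v) = 0 := by
  obtain ⟨z, rfl⟩ := Submodule.mkQ_surjective _ v
  induction z with
  | zero => simp
  | add x y hx hy => rw [map_add, map_add, map_add, hx, hy, add_zero]
  | tmul b d =>
    have e := coderivation_mk_tmul (K := K) b d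
    rw [e]
    simp [mul_comm]

theorem coactL_mk_tmul (b d : C) :
    (cokerComul K C).coactL (cokerComulMk K C (b ⊗ₜ d)) = (cokerComulMk K C).lTensor C
      (TensorProduct.assoc K C C C (comul b ⊗ₜ d)) :=
  LinearMap.congr_fun (isHom_cokerComulMk K C).left (b ⊗ₜ d)

theorem coactR_mk_tmul (b d : C) :
    (cokerComul K C).coactR (cokerComulMk K C (b ⊗ₜ d)) = (cokerComulMk K C).rTensor C
      ((TensorProduct.assoc K C C C).symm (b ⊗ₜ comul d)) :=
  LinearMap.congr_fun (isHom_cokerComulMk K C).right (b ⊗ₜ d)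

/-- On the class of `b ⊗ d` the two terms are `b ⊗ d - ε(b) Δ(d)` and `ε(d) Δ(b) - b ⊗ d`; the mixed
terms cancel. -/
theorem comul_coderivation (v : CokerComul K C) : comul (coderivation K C v) =
    (coderivation K C).rTensor C ((cokerComul K C).coactR v) +
      (coderivation K C).lTensor C ((cokerComul K C).coactL v) := by
  obtain ⟨z, rfl⟩ := Submodule.mkQ_surjective _ v
  induction z with
  | zero => simp
  | add x y hx hy =>
    simp only [map_add] at hx hy ⊢
    rw [hx, hy]
    abel
  | tmul b d =>
    have h1 : ∀ w : C ⊗[K] C, (coderivation K C).rTensor C ((cokerComulMk K C).rTensor C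
        ((TensorProduct.assoc K C C C).symm (b ⊗ₜ w))) =
          b ⊗ₜ[K] TensorProduct.lid K C (counit.rTensor C w) - counit (R := K) b • w := by
      intro w
      induction w with
      | zero => simp
      | add x y hx hy =>
        simp only [TensorProduct.tmul_add, map_add, smul_add, hx, hy]
        abel
      | tmul p q =>
        simp only [TensorProduct.assoc_symm_tmul, LinearMap.rTensor_tmul, coderivation_mk_tmul]
        simp [TensorProduct.sub_tmul, TensorProduct.smul_tmul']
    have h2 : ∀ w : C ⊗[K] C, (coderivation K C).lTensor C ((cokerComulMk K C).lTensor C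
        (TensorProduct.assoc K C C C (w ⊗ₜ d))) =
          counit (R := K) d • w - TensorProduct.rid K C (counit.lTensor C w) ⊗ₜ[K] d := by
      intro w
      induction w with
      | zero => simp
      | add x y hx hy =>
        simp only [TensorProduct.add_tmul, map_add, smul_add, hx, hy]
        abel
      | tmul p q =>
        simp only [TensorProduct.assoc_tmul, LinearMap.lTensor_tmul, coderivation_mk_tmul]
        simp [TensorProduct.tmul_sub, TensorProduct.smul_tmul]
    have e1 := coactL_mk_tmul (K := K) b d
    have e2 := coactR_mk_tmul (K := K) b d
    have e3 := coderivation_mk_tmul (K := K) b d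
    rw [e1, e2, e3, h1, h2]
    simp

end Bicomodule

open Bicomodule

/-- For a formally smooth bialgebra `A`, the universal coderivation yields a map `ψ : A ⊗ A → A`
with `ψ ∘ Δ = 0`, `ψ(1 ⊗ d) = ε(d) - d` and `Δ ψ(b ⊗ d) = ψ(b ⊗ d₁) ⊗ d₂ + 1 ⊗ ψ(b ⊗ d)`. -/
theorem IsFormallySmoothCoalgebra.exists_coderivation {K : Type u} {A : Type v} [Field K] [Ring A]
    [Bialgebra K A] (hA : IsFormallySmoothCoalgebra K A) : ∃ ψ : A ⊗[K] A →ₗ[K] A,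
      (∀ z, counit (R := K) (ψ z) = 0) ∧
      (∀ b, ψ (comul b) = 0) ∧ (∀ d, ψ (1 ⊗ₜ d) = algebraMap K A (counit d) - d) ∧
      ∀ z, comul (ψ z) = ψ.rTensor A ((TensorProduct.assoc K A A A).symm (comul.lTensor A z)) +
        1 ⊗ₜ ψ z := by
  obtain ⟨τ, hτ, hτ'⟩ := hA.exists_retraction
  -- `ψ(z) = δ(τ(1 ⊗ [z]))`, with `δ` the universal coderivation and `τ` the retraction.
  refine ⟨coderivation K A ∘ₗ τ ∘ₗ TensorProduct.mk K A _ 1 ∘ₗ cokerComulMk K A,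
    fun z => counit_coderivation _, ?_, ?_, ?_⟩
  · intro b
    have : cokerComulMk K A (comul b) = 0 := (Submodule.Quotient.mk_eq_zero _).mpr ⟨b, rfl⟩
    simp only [LinearMap.comp_apply, this, map_zero]
  · intro d
    -- Since `1` is grouplike, `1 ⊗ [1 ⊗ d]` is the left coaction of `[1 ⊗ d]`, on which `τ` is
    -- known.
    have h1 : (1 : A) ⊗ₜ[K] cokerComulMk K A (1 ⊗ₜ d) =
        (cokerComul K A).coactL (cokerComulMk K A (1 ⊗ₜ d)) := by
      rw [coactL_mk_tmul, Bialgebra.comul_one, Algebra.TensorProduct.one_def,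
        TensorProduct.assoc_tmul, LinearMap.lTensor_tmul]
    simp only [LinearMap.comp_apply, TensorProduct.mk_apply]
    rw [h1, ← LinearMap.comp_apply τ, hτ', LinearMap.id_apply, coderivation_mk_tmul,
      Bialgebra.counit_one, one_smul, Algebra.algebraMap_eq_smul_one]
  · intro z
    induction z with
    | zero => simp
    | add x y hx hy =>
      simp only [map_add, TensorProduct.tmul_add, hx, hy]
      abel
    | tmul b d =>
      simp only [LinearMap.comp_apply, TensorProduct.mk_apply]
      rw [comul_coderivation]
      -- By colinearity of `τ` the coactions can be computed in `A ⊗ ℧₁ A`, where the left one only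
      -- duplicates the grouplike `1`: hence the term `1 ⊗ ψ(z)`.
      have hl := LinearMap.congr_fun hτ.left ((1 : A) ⊗ₜ[K] cokerComulMk K A (b ⊗ₜ d))
      have hr := LinearMap.congr_fun hτ.right ((1 : A) ⊗ₜ[K] cokerComulMk K A (b ⊗ₜ d))
      rw [LinearMap.comp_apply] at hl hr
      rw [hl, hr]
      congr 1
      · simp only [LinearMap.comp_apply, tensorLeft_coactR, LinearMap.lTensor_tmul,
          LinearEquiv.coe_coe, coactR_mk_tmul]
        generalize comul (R := K) d = w
        induction w with
        | zero => simp
        | add x y hx hy => simp only [TensorProduct.tmul_add, map_add, hx, hy]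
        | tmul p q => simp
      · simp [Algebra.TensorProduct.one_def]

/-! ### Antipode identities and averaging over `A` -/

section Averaging

open HopfAlgebra (antipode)
open WithConv

variable {K : Type u} {A : Type v} [Field K] [Ring A] [HopfAlgebra K A]

theorem toConv_algHom_comp_antipode_mul {B : Type v} [Ring B] [Algebra K B] (h : A →ₐ[K] B) :
    toConv (h.toLinearMap ∘ₗ antipode K) * toConv h.toLinearMap = 1 := by
  have := LinearMap.algHom_comp_convMul_distrib h (toConv (antipode K (A := A)))
    (toConv LinearMap.id)
  rw [LinearMap.antipode_mul_id] at this
  apply WithConv.ext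
  refine Eq.trans this.symm ?_
  ext
  simp [LinearMap.convOne_def]

theorem toConv_algHom_mul_comp_antipode {B : Type v} [Ring B] [Algebra K B] (h : A →ₐ[K] B) :
    toConv h.toLinearMap * toConv (h.toLinearMap ∘ₗ antipode K) = 1 := by
  have := LinearMap.algHom_comp_convMul_distrib h (toConv LinearMap.id)
    (toConv (antipode K (A := A)))
  rw [LinearMap.id_mul_antipode] at this
  apply WithConv.ext
  refine Eq.trans this.symm ?_
  ext
  simp [LinearMap.convOne_def]

/-- `Δ(a) = (a₁ ⊗ 1)(1 ⊗ a₂)`. Every algebra map is convolution invertible with inverse its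
composite with `S`, so solving this equation yields the two antipode identities that follow. -/
theorem includeLeft_mul_includeRight :
    toConv (Algebra.TensorProduct.includeLeft : A →ₐ[K] A ⊗[K] A).toLinearMap *
      toConv (Algebra.TensorProduct.includeRight : A →ₐ[K] A ⊗[K] A).toLinearMap =
      toConv (Bialgebra.comulAlgHom K A).toLinearMap := by
  apply WithConv.ext
  ext a
  rw [LinearMap.convMul_def]
  simp only [LinearMap.comp_apply, AlgHom.toLinearMap_apply,
    Bialgebra.comulAlgHom_apply]
  generalize comul (R := K) a = w
  induction w with
  | zero => simp
  | add x y hx hy => simp only [map_add, hx, hy]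
  | tmul p q => simp

/-- `Δ(S(a₁)) (a₂ ⊗ 1) = 1 ⊗ S(a)`. -/
theorem comul_antipode_mul_includeLeft (a : A) :
    LinearMap.mul' K (A ⊗[K] A) (TensorProduct.map (comul ∘ₗ antipode K)
      (Algebra.TensorProduct.includeLeft : A →ₐ[K] A ⊗[K] A).toLinearMap (comul a)) =
      1 ⊗ₜ[K] antipode K a := by
  have h : toConv ((Bialgebra.comulAlgHom K A).toLinearMap ∘ₗ antipode K) *
      toConv (Algebra.TensorProduct.includeLeft : A →ₐ[K] A ⊗[K] A).toLinearMap =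
      toConv ((Algebra.TensorProduct.includeRight : A →ₐ[K] A ⊗[K] A).toLinearMap ∘ₗ
        antipode K) := by
    have h1 := congrArg (· * toConv ((Algebra.TensorProduct.includeRight :
      A →ₐ[K] A ⊗[K] A).toLinearMap ∘ₗ antipode K)) (includeLeft_mul_includeRight (K := K) (A := A))
    simp only [mul_assoc, toConv_algHom_mul_comp_antipode, mul_one] at h1
    rw [h1, ← mul_assoc, toConv_algHom_comp_antipode_mul, one_mul]
  exact LinearMap.congr_fun (congrArg ofConv h) a

/-- `(1 ⊗ a₁) Δ(S(a₂)) = S(a) ⊗ 1`. -/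
theorem includeRight_mul_comul_antipode (a : A) :
    LinearMap.mul' K (A ⊗[K] A) (TensorProduct.map
      (Algebra.TensorProduct.includeRight : A →ₐ[K] A ⊗[K] A).toLinearMap
      (comul ∘ₗ antipode K) (comul a)) = antipode K a ⊗ₜ[K] 1 := by
  have h : toConv (Algebra.TensorProduct.includeRight : A →ₐ[K] A ⊗[K] A).toLinearMap *
      toConv ((Bialgebra.comulAlgHom K A).toLinearMap ∘ₗ antipode K) =
      toConv ((Algebra.TensorProduct.includeLeft : A →ₐ[K] A ⊗[K] A).toLinearMap ∘ₗ
        antipode K) := by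
    have h1 := congrArg (toConv ((Algebra.TensorProduct.includeLeft :
      A →ₐ[K] A ⊗[K] A).toLinearMap ∘ₗ antipode K) * ·)
        (includeLeft_mul_includeRight (K := K) (A := A))
    simp only [← mul_assoc, toConv_algHom_comp_antipode_mul, one_mul] at h1
    rw [h1, mul_assoc, toConv_algHom_mul_comp_antipode, mul_one]
  exact LinearMap.congr_fun (congrArg ofConv h) a

theorem mul'_antipode_mul_left (t y : A) :
    LinearMap.mul' K A ((antipode K ∘ₗ LinearMap.mulRight K t).rTensor A (comul y)) =
      counit (R := K) y • antipode K t := by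
  have h : ∀ w : A ⊗[K] A, LinearMap.mul' K A
      ((antipode K ∘ₗ LinearMap.mulRight K t).rTensor A w) =
        antipode K t * LinearMap.mul' K A ((antipode K).rTensor A w) := by
    intro w
    induction w with
    | zero => simp
    | add x y hx hy => simp only [map_add, mul_add, hx, hy]
    | tmul p q => simp [HopfAlgebra.antipode_mul_antidistrib, mul_assoc]
  rw [h, HopfAlgebra.mul_antipode_rTensor_comul_apply, ← Algebra.commutes, Algebra.smul_def]

/-- `(g₁ a)₁ ⊗ S((g₁ a)₂) g₂ = g a₁ ⊗ S(a₂)`. -/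
theorem comul_mul_antipode_mul (g a : A) :
    LinearMap.mul' K (A ⊗[K] A) (TensorProduct.map
      ((antipode K).lTensor A ∘ₗ comul ∘ₗ LinearMap.mulRight K a)
      (Algebra.TensorProduct.includeRight : A →ₐ[K] A ⊗[K] A).toLinearMap (comul g)) =
      (g ⊗ₜ[K] 1) * (antipode K).lTensor A (comul a) := by
  -- `Δ(ga) = Δ(g) Δ(a)`; freeing `w` from `Δ(a)` allows `w = s ⊗ t`, and then only `S(g₂ t) g₃ =
  -- ε(g₂) S(t)` is needed.
  have h : ∀ w : A ⊗[K] A, LinearMap.mul' K (A ⊗[K] A) (TensorProduct.map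
      ((antipode K).lTensor A ∘ₗ LinearMap.mulRight K w ∘ₗ comul)
      (Algebra.TensorProduct.includeRight : A →ₐ[K] A ⊗[K] A).toLinearMap (comul g)) =
      (g ⊗ₜ[K] 1) * (antipode K).lTensor A w := by
    intro w
    induction w with
    | zero => simp
    | add x y hx hy =>
      rw [map_add, mul_add, ← hx, ← hy]
      generalize comul (R := K) g = z
      clear hx hy
      induction z with
      | zero => simp
      | add x y hx hy => simp only [map_add, hx, hy]; abel
      | tmul p q => simp [mul_add, add_mul]
    | tmul s t =>
      let F : A ⊗[K] (A ⊗[K] A) →ₗ[K] A ⊗[K] A := TensorProduct.map (LinearMap.mulRight K s)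
        (LinearMap.mul' K A ∘ₗ (antipode K ∘ₗ LinearMap.mulRight K t).rTensor A)
      have h1 : ∀ z : A ⊗[K] A, LinearMap.mul' K (A ⊗[K] A) (TensorProduct.map
          ((antipode K).lTensor A ∘ₗ LinearMap.mulRight K (s ⊗ₜ t) ∘ₗ comul)
          (Algebra.TensorProduct.includeRight : A →ₐ[K] A ⊗[K] A).toLinearMap z) =
          F (TensorProduct.assoc K A A A (comul.rTensor A z)) := by
        intro z
        induction z with
        | zero => simp
        | add x y hx hy => simp only [map_add, hx, hy]
        | tmul p q =>
          simp only [TensorProduct.map_tmul, LinearMap.mul'_apply, LinearMap.comp_apply,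
            LinearMap.rTensor_tmul]
          generalize comul (R := K) p = w
          induction w with
          | zero => simp
          | add x y hx hy =>
            simp only [map_add, add_mul, TensorProduct.add_tmul] at hx hy ⊢
            rw [hx, hy]
          | tmul x y => simp [F]
      have h2 : ∀ z : A ⊗[K] A, F (comul.lTensor A z) =
          (TensorProduct.rid K A (counit.lTensor A z) * s) ⊗ₜ[K] antipode K t := by
        intro z
        induction z with
        | zero => simp
        | add x y hx hy => simp only [map_add, add_mul, TensorProduct.add_tmul, hx, hy]
        | tmul p q =>
          simp only [LinearMap.lTensor_tmul, F, TensorProduct.map_tmul, LinearMap.comp_apply,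
            mul'_antipode_mul_left]
          simp [TensorProduct.smul_tmul']
      rw [h1, coassoc_apply, h2]
      simp
  rw [← h (comul a)]
  congr 2
  congr 1
  ext x
  simp

/-- The map `A ⊗ (A ⊗ A) → A`, `a ⊗ z ↦ a₁ ψ(S(a₂) z)`. -/
def averaged (ψ : A ⊗[K] A →ₗ[K] A) : A ⊗[K] (A ⊗[K] A) →ₗ[K] A :=
  LinearMap.mul' K A ∘ₗ (ψ ∘ₗ LinearMap.mul' K (A ⊗[K] A) ∘ₗ
    comul.rTensor (A ⊗[K] A)).lTensor A ∘ₗ (TensorProduct.assoc K A A (A ⊗[K] A)).toLinearMap ∘ₗ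
      ((antipode K).lTensor A ∘ₗ comul).rTensor (A ⊗[K] A)

/-- The map `p ⊗ q ↦ p ψ(Δ(q) z)`. -/
def averagedAux (ψ : A ⊗[K] A →ₗ[K] A) (z : A ⊗[K] A) : A ⊗[K] A →ₗ[K] A :=
  LinearMap.mul' K A ∘ₗ (ψ ∘ₗ LinearMap.mulRight K z ∘ₗ comul).lTensor A

theorem averagedAux_tmul (ψ : A ⊗[K] A →ₗ[K] A) (z : A ⊗[K] A) (p q : A) :
    averagedAux ψ z (p ⊗ₜ q) = p * ψ (comul q * z) := by
  simp [averagedAux]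

theorem averaged_tmul (ψ : A ⊗[K] A →ₗ[K] A) (a : A) (z : A ⊗[K] A) :
    averaged ψ (a ⊗ₜ z) = averagedAux ψ z ((antipode K).lTensor A (comul a)) := by
  simp only [averaged, LinearMap.comp_apply, LinearMap.rTensor_tmul]
  generalize (antipode K).lTensor A (comul a) = w
  induction w with
  | zero => simp
  | add x y hx hy => simp only [map_add, TensorProduct.add_tmul, hx, hy]
  | tmul p q => simp [averagedAux_tmul]

/-- The identity `comul_mul_antipode_mul` absorbs the action on `z`: `(g₁a)₁ ψ(S((g₁a)₂) g₂ z) = g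
a₁ ψ(S(a₂) z)`. -/
theorem averaged_linear (ψ : A ⊗[K] A →ₗ[K] A) (g : A) (y : A ⊗[K] (A ⊗[K] A)) :
    averaged ψ (comul.lTensor A (comul g) * y) = g * averaged ψ y := by
  induction y with
  | zero => simp
  | add x y hx hy => simp only [map_add, mul_add, hx, hy]
  | tmul a z =>
    have h1 : ∀ w : A ⊗[K] A, averaged ψ (comul.lTensor A w * (a ⊗ₜ z)) =
        averagedAux ψ z (LinearMap.mul' K (A ⊗[K] A) (TensorProduct.map
          ((antipode K).lTensor A ∘ₗ comul ∘ₗ LinearMap.mulRight K a)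
          (Algebra.TensorProduct.includeRight : A →ₐ[K] A ⊗[K] A).toLinearMap w)) := by
      intro w
      induction w with
      | zero => simp
      | add x y hx hy => simp only [map_add, add_mul, hx, hy]
      | tmul p q =>
        simp only [LinearMap.lTensor_tmul, Algebra.TensorProduct.tmul_mul_tmul, averaged_tmul,
          TensorProduct.map_tmul, LinearMap.mul'_apply, LinearMap.comp_apply,
          LinearMap.mulRight_apply]
        generalize (antipode K).lTensor A (comul (p * a)) = v
        induction v with
        | zero => simp
        | add x y hx hy => simp only [map_add, add_mul, hx, hy]
        | tmul x y => simp [averagedAux_tmul, mul_assoc]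
    rw [h1, comul_mul_antipode_mul, averaged_tmul]
    generalize (antipode K).lTensor A (comul a) = v
    induction v with
    | zero => simp
    | add x y hx hy => simp only [map_add, mul_add, hx, hy]
    | tmul x y => simp [averagedAux_tmul, mul_assoc]

theorem counit_averaged {ψ : A ⊗[K] A →ₗ[K] A} (h0 : ∀ z, counit (R := K) (ψ z) = 0)
    (y : A ⊗[K] (A ⊗[K] A)) : counit (R := K) (averaged ψ y) = 0 := by
  induction y with
  | zero => simp
  | add x y hx hy => simp only [map_add, hx, hy, add_zero]
  | tmul a z =>
    rw [averaged_tmul]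
    generalize (antipode K).lTensor A (comul a) = v
    induction v with
    | zero => simp
    | add x y hx hy => simp only [map_add, hx, hy, add_zero]
    | tmul x y => rw [averagedAux_tmul, Bialgebra.counit_mul, h0, mul_zero]

/-- The image of `Δ` is stable under the diagonal action: the value is `a₁ ψ(Δ(S(a₂) b))`. -/
theorem averaged_tmul_comul {ψ : A ⊗[K] A →ₗ[K] A} (h1 : ∀ b, ψ (comul b) = 0) (a b : A) :
    averaged ψ (a ⊗ₜ comul b) = 0 := by
  rw [averaged_tmul]
  generalize (antipode K).lTensor A (comul a) = v
  induction v with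
  | zero => simp
  | add x y hx hy => simp only [map_add, hx, hy, add_zero]
  | tmul x y => rw [averagedAux_tmul, ← Bialgebra.comul_mul, h1, mul_zero]

/-- `Δ(S(b₂))(b₃ ⊗ d)` collapses to `1 ⊗ S(b₂) d`, where `ψ` is known; what remains is `b₁ (ε(S(b₂)
d) - S(b₂) d)`. -/
theorem averaged_comul_tmul {ψ : A ⊗[K] A →ₗ[K] A}
    (h2 : ∀ d, ψ (1 ⊗ₜ d) = algebraMap K A (counit d) - d) (b d : A) :
    averaged ψ (TensorProduct.assoc K A A A (comul b ⊗ₜ d)) =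
      counit (R := K) d • b - counit (R := K) b • d := by
  let F : A ⊗[K] (A ⊗[K] A) →ₗ[K] A := LinearMap.mul' K A ∘ₗ (ψ ∘ₗ
    LinearMap.mulRight K (1 ⊗ₜ d) ∘ₗ LinearMap.mul' K (A ⊗[K] A) ∘ₗ
      TensorProduct.map (comul ∘ₗ antipode K)
        (Algebra.TensorProduct.includeLeft : A →ₐ[K] A ⊗[K] A).toLinearMap).lTensor A
  have e1 : ∀ z : A ⊗[K] A, averaged ψ (TensorProduct.assoc K A A A (z ⊗ₜ d)) =
      F (TensorProduct.assoc K A A A (comul.rTensor A z)) := by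
    intro z
    induction z with
    | zero => simp
    | add x y hx hy => simp only [map_add, TensorProduct.add_tmul, hx, hy]
    | tmul p q =>
      simp only [TensorProduct.assoc_tmul, averaged_tmul, LinearMap.rTensor_tmul]
      generalize comul (R := K) p = w
      induction w with
      | zero => simp
      | add x y hx hy => simp only [map_add, TensorProduct.add_tmul, hx, hy]
      | tmul x y => simp [F, averagedAux_tmul, mul_assoc]
  have e2 : ∀ z : A ⊗[K] A, F (comul.lTensor A z) =
      counit (R := K) d • TensorProduct.rid K A (counit.lTensor A z) -
        LinearMap.mul' K A ((antipode K).lTensor A z) * d := by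
    intro z
    induction z with
    | zero => simp
    | add x y hx hy => simp only [map_add, smul_add, add_mul, hx, hy]; abel
    | tmul p q =>
      simp only [LinearMap.lTensor_tmul, F, LinearMap.comp_apply,
        comul_antipode_mul_includeLeft]
      simp [h2, mul_sub, mul_assoc, Algebra.algebraMap_eq_smul_one, smul_smul, mul_comm]
  rw [e1, coassoc_apply, e2, HopfAlgebra.mul_antipode_lTensor_comul_apply]
  simp [Algebra.smul_def]

/-- `z ↦ (b ⊗ d₁) ⊗ d₂` for `z = b ⊗ d`. -/
abbrev comulRight (K : Type u) (A : Type v) [Field K] [Ring A] [Bialgebra K A] :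
    A ⊗[K] A →ₗ[K] (A ⊗[K] A) ⊗[K] A :=
  (TensorProduct.assoc K A A A).symm.toLinearMap ∘ₗ comul.lTensor A

theorem comulRight_mul (s : A) (z : A ⊗[K] A) :
    comulRight K A (comul s * z) = comul.rTensor A (comul s) * comulRight K A z := by
  have h : ∀ w, comulRight K A (w * z) = comulRight K A w * comulRight K A z := by
    intro w
    let f : A ⊗[K] A →ₐ[K] (A ⊗[K] A) ⊗[K] A :=
      (Algebra.TensorProduct.assoc K K K A A A).symm.toAlgHom.comp
        (Algebra.TensorProduct.map (AlgHom.id K A) (Bialgebra.comulAlgHom K A))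
    have hf : comulRight K A = f.toLinearMap := by
      ext
      rfl
    rw [hf]
    exact map_mul f w z
  rw [h]
  congr 1
  simp [comulRight]

/-- Expand `Δ(a₁) Δ(ψ(S(a₂) z))` by `h3`. The summand `1 ⊗ ψ` gives `a₁ ⊗ a₂ ψ(S(a₃) z)`. In the
other one the antipode also acts on the outer right leg, and `(1 ⊗ a₁) Δ(S(a₂)) = S(a) ⊗ 1` removes
it there. -/
theorem comul_averaged {ψ : A ⊗[K] A →ₗ[K] A}
    (h3 : ∀ z, comul (ψ z) = ψ.rTensor A (comulRight K A z) + 1 ⊗ₜ ψ z)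
    (a : A) (z : A ⊗[K] A) :
    comul (averaged ψ (a ⊗ₜ z)) =
      (averaged ψ).rTensor A ((TensorProduct.assoc K A (A ⊗[K] A) A).symm
        (a ⊗ₜ comulRight K A z)) +
      (averaged ψ).lTensor A (TensorProduct.assoc K A A (A ⊗[K] A) (comul a ⊗ₜ z)) := by
  let G (z' : (A ⊗[K] A) ⊗[K] A) : A ⊗[K] A →ₗ[K] A ⊗[K] A :=
    LinearMap.mul' K (A ⊗[K] A) ∘ₗ TensorProduct.map comul (ψ.rTensor A ∘ₗ
      LinearMap.mulRight K z' ∘ₗ comul.rTensor A ∘ₗ comul ∘ₗ antipode K)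
  let F : A ⊗[K] (A ⊗[K] A) →ₗ[K] A ⊗[K] A :=
    (averagedAux ψ z ∘ₗ (antipode K).lTensor A).lTensor A
  have hG : ∀ z', G z' (comul a) = (averaged ψ).rTensor A
      ((TensorProduct.assoc K A (A ⊗[K] A) A).symm (a ⊗ₜ z')) := by
    intro z'
    induction z' with
    | zero =>
      generalize comul (R := K) a = w
      rw [TensorProduct.tmul_zero, map_zero, map_zero]
      induction w with
      | zero => simp
      | add x y hx hy => simp only [map_add, hx, hy, add_zero]
      | tmul p q => simp [G]
    | add x y hx hy =>
      simp only [TensorProduct.tmul_add, map_add, ← hx, ← hy]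
      clear hx hy
      generalize comul (R := K) a = w
      induction w with
      | zero => simp
      | add x y hx hy => simp only [map_add, hx, hy]; abel
      | tmul p q => simp [G, mul_add]
    | tmul u e =>
      let Q : A ⊗[K] A →ₗ[K] A ⊗[K] A :=
        TensorProduct.map (ψ ∘ₗ LinearMap.mulRight K u ∘ₗ comul) (LinearMap.mulRight K e)
      have hQ : ∀ v : A ⊗[K] A, ψ.rTensor A (comul.rTensor A v * (u ⊗ₜ e)) = Q v := by
        intro v
        induction v with
        | zero => simp
        | add x y hx hy => simp only [map_add, add_mul, hx, hy]
        | tmul p q => simp [Q]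
      let F1 : A ⊗[K] (A ⊗[K] A) →ₗ[K] A ⊗[K] A := LinearMap.mul' K (A ⊗[K] A) ∘ₗ
        TensorProduct.map (Algebra.TensorProduct.includeLeft : A →ₐ[K] A ⊗[K] A).toLinearMap
          (Q ∘ₗ LinearMap.mul' K (A ⊗[K] A) ∘ₗ TensorProduct.map
            (Algebra.TensorProduct.includeRight : A →ₐ[K] A ⊗[K] A).toLinearMap
            (comul ∘ₗ antipode K))
      have e1 : ∀ w : A ⊗[K] A, G (u ⊗ₜ e) w =
          F1 (TensorProduct.assoc K A A A (comul.rTensor A w)) := by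
        intro w
        induction w with
        | zero => simp
        | add x y hx hy => simp only [map_add, hx, hy]
        | tmul p q =>
          simp only [G, F1, LinearMap.comp_apply, TensorProduct.map_tmul, LinearMap.mul'_apply,
            LinearMap.mulRight_apply, hQ, LinearMap.rTensor_tmul]
          generalize comul (R := K) p = v
          induction v with
          | zero => simp
          | add x y hx hy => simp only [map_add, add_mul, TensorProduct.add_tmul, hx, hy]
          | tmul x y =>
            simp only [TensorProduct.assoc_tmul, TensorProduct.map_tmul, LinearMap.comp_apply,
              LinearMap.mul'_apply]
            generalize comul (R := K) (antipode K q) = v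
            induction v with
            | zero => simp
            | add x y hx hy => simp only [map_add, mul_add, hx, hy]
            | tmul s t => simp [Q, mul_assoc]
      have e2 : ∀ w : A ⊗[K] A, F1 (comul.lTensor A w) =
          averagedAux ψ u ((antipode K).lTensor A w) ⊗ₜ e := by
        intro w
        induction w with
        | zero => simp
        | add x y hx hy => simp only [map_add, TensorProduct.add_tmul, hx, hy]
        | tmul p q =>
          simp only [LinearMap.lTensor_tmul, F1, TensorProduct.map_tmul, LinearMap.comp_apply,
            includeRight_mul_comul_antipode]
          simp [Q, averagedAux_tmul]
      rw [e1, coassoc_apply, e2, TensorProduct.assoc_symm_tmul, LinearMap.rTensor_tmul,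
        averaged_tmul]
  have e1 : ∀ w : A ⊗[K] A, comul (averagedAux ψ z ((antipode K).lTensor A w)) =
      G (comulRight K A z) w + F (TensorProduct.assoc K A A A (comul.rTensor A w)) := by
    intro w
    induction w with
    | zero => simp
    | add x y hx hy => simp only [map_add, hx, hy]; abel
    | tmul p q =>
      rw [LinearMap.lTensor_tmul, averagedAux_tmul, Bialgebra.comul_mul, h3, comulRight_mul,
        mul_add]
      congr 1
      rw [LinearMap.rTensor_tmul]
      generalize comul (R := K) p = w
      induction w with
      | zero => simp
      | add x y hx hy => simp only [map_add, add_mul, TensorProduct.add_tmul, hx, hy]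
      | tmul x y => simp [F, averagedAux_tmul]
  have e2 : ∀ w : A ⊗[K] A, F (comul.lTensor A w) =
      (averaged ψ).lTensor A (TensorProduct.assoc K A A (A ⊗[K] A) (w ⊗ₜ z)) := by
    intro w
    induction w with
    | zero => simp
    | add x y hx hy => simp only [map_add, TensorProduct.add_tmul, hx, hy]
    | tmul p q => simp [F, averaged_tmul]
  rw [averaged_tmul, e1, coassoc_apply, e2, hG]

end Averaging

/-! ### A left `A`-linear retraction -/

section LinearRetraction

open HopfAlgebra (antipode)

variable {K : Type u} {A E : Type v} [Field K] [Ring A] [HopfAlgebra K A] [Ring E] [Bialgebra K E]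
  (ι : A →ₐc[K] E)

theorem comul_bialgHom (a : A) :
    comul (R := K) (ι a) = TensorProduct.map (ι : A →ₗ[K] E) (ι : A →ₗ[K] E) (comul a) :=
  (CoalgHomClass.map_comp_comul_apply ι a).symm

/-- The defect of left `A`-linearity of a map `p : E → A`. -/
def linearityDefect (p : E →ₗ[K] A) : A ⊗[K] E →ₗ[K] A :=
  p ∘ₗ LinearMap.mul' K E ∘ₗ (ι : A →ₗ[K] E).rTensor E - LinearMap.mul' K A ∘ₗ p.lTensor A

theorem linearityDefect_tmul (p : E →ₗ[K] A) (h : A) (y : E) :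
    linearityDefect ι p (h ⊗ₜ y) = p (ι h * y) - h * p y := by
  simp [linearityDefect]

/-- The cocycle identity of the defect, from associativity of the action. -/
theorem linearityDefect_tmul_mul (p : E →ₗ[K] A) (k g : A) (y : E) :
    linearityDefect ι p (k ⊗ₜ (ι g * y)) =
      linearityDefect ι p ((k * g) ⊗ₜ y) - k * linearityDefect ι p (g ⊗ₜ y) := by
  simp only [linearityDefect_tmul, map_mul, mul_sub, mul_assoc]
  abel

/-- The map `p ⊗ q ↦ p D(q ⊗ y)`, where `D` is the defect of linearity. -/
def averagedDefectAux (p : E →ₗ[K] A) (y : E) : A ⊗[K] A →ₗ[K] A :=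
  LinearMap.mul' K A ∘ₗ (linearityDefect ι p ∘ₗ (TensorProduct.mk K A E).flip y).lTensor A

theorem averagedDefectAux_tmul (p : E →ₗ[K] A) (y : E) (a b : A) :
    averagedDefectAux ι p y (a ⊗ₜ b) = a * linearityDefect ι p (b ⊗ₜ y) := by
  simp [averagedDefectAux]

/-- The map `k ⊗ y ↦ k₁ D(S(k₂) ⊗ y)`, where `D` is the defect of linearity. -/
def averagedDefect (p : E →ₗ[K] A) : A ⊗[K] E →ₗ[K] A :=
  LinearMap.mul' K A ∘ₗ (linearityDefect ι p).lTensor A ∘ₗ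
    (TensorProduct.assoc K A A E).toLinearMap ∘ₗ ((antipode K).lTensor A ∘ₗ comul).rTensor E

theorem averagedDefect_tmul (p : E →ₗ[K] A) (k : A) (y : E) :
    averagedDefect ι p (k ⊗ₜ y) =
      averagedDefectAux ι p y ((antipode K).lTensor A (comul k)) := by
  simp only [averagedDefect, LinearMap.comp_apply, LinearMap.rTensor_tmul]
  generalize (antipode K).lTensor A (comul k) = w
  induction w with
  | zero => simp
  | add x y hx hy => simp only [map_add, TensorProduct.add_tmul, hx, hy]
  | tmul p q => simp [averagedDefectAux_tmul]

theorem averagedDefect_tmul_eq_zero (p : E →ₗ[K] A) (k : A) {y : E}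
    (hy : ∀ h : A, p (ι h * y) = h * p y) : averagedDefect ι p (k ⊗ₜ y) = 0 := by
  rw [averagedDefect_tmul]
  generalize (antipode K).lTensor A (comul k) = w
  induction w with
  | zero => simp
  | add x y hx hy => simp only [map_add, hx, hy, add_zero]
  | tmul a b => rw [averagedDefectAux_tmul, linearityDefect_tmul, hy, sub_self, mul_zero]

/-- The averaged defect fails to be linear exactly by the defect itself. Apply the cocycle identity
to `(g₁h)₁ D(S((g₁h)₂) ⊗ g₂y)`: the first term simplifies by `comul_mul_antipode_mul`, the second by
`k₁ S(k₂) = ε(k)`. -/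
theorem averagedDefect_comul_mul (p : E →ₗ[K] A) (g h : A) (y : E) :
    averagedDefect ι p (TensorProduct.map (LinearMap.mulRight K h)
      (LinearMap.mulRight K y ∘ₗ (ι : A →ₗ[K] E)) (comul g)) =
      g * averagedDefect ι p (h ⊗ₜ y) - counit (R := K) h • linearityDefect ι p (g ⊗ₜ y) := by
  have e : ∀ w : A ⊗[K] A, averagedDefect ι p (TensorProduct.map (LinearMap.mulRight K h)
      (LinearMap.mulRight K y ∘ₗ (ι : A →ₗ[K] E)) w) =
      averagedDefectAux ι p y (LinearMap.mul' K (A ⊗[K] A) (TensorProduct.map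
        ((antipode K).lTensor A ∘ₗ comul ∘ₗ LinearMap.mulRight K h)
        (Algebra.TensorProduct.includeRight : A →ₐ[K] A ⊗[K] A).toLinearMap w)) -
      counit (R := K) h • linearityDefect ι p
        (TensorProduct.lid K A (counit.rTensor A w) ⊗ₜ y) := by
    intro w
    induction w with
    | zero => simp
    | add x y hx hy => simp only [map_add, TensorProduct.add_tmul, smul_add, hx, hy]; abel
    | tmul a b =>
      have e1 : ∀ v : A ⊗[K] A, averagedDefectAux ι p (ι b * y) v =
          averagedDefectAux ι p y (v * (1 ⊗ₜ b)) -
            LinearMap.mul' K A v * linearityDefect ι p (b ⊗ₜ y) := by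
        intro v
        induction v with
        | zero => simp
        | add x y hx hy => simp only [map_add, add_mul, hx, hy]; abel
        | tmul s t =>
          simp [averagedDefectAux_tmul, linearityDefect_tmul_mul, mul_sub, mul_assoc]
      simp only [TensorProduct.map_tmul, LinearMap.comp_apply, LinearMap.mulRight_apply,
        averagedDefect_tmul, LinearMap.mul'_apply]
      refine (e1 _).trans ?_
      rw [HopfAlgebra.mul_antipode_lTensor_comul_apply]
      simp [Algebra.algebraMap_eq_smul_one, smul_smul, mul_comm, ← TensorProduct.smul_tmul']
  rw [e, comul_mul_antipode_mul, averagedDefect_tmul]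
  congr 1
  · generalize (antipode K).lTensor A (comul h) = v
    induction v with
    | zero => simp
    | add x y hx hy => simp only [map_add, mul_add, hx, hy]
    | tmul x y => simp [averagedDefectAux_tmul, mul_assoc]
  · simp

theorem counit_averagedDefect {p : E →ₗ[K] A} (hp : ∀ x, counit (R := K) (p x) = counit (R := K) x)
    (z : A ⊗[K] E) : counit (R := K) (averagedDefect ι p z) = 0 := by
  induction z with
  | zero => simp
  | add x y hx hy => simp only [map_add, hx, hy, add_zero]
  | tmul a y =>
    rw [averagedDefect_tmul]
    generalize (antipode K).lTensor A (comul a) = v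
    induction v with
    | zero => simp
    | add x y hx hy => simp only [map_add, hx, hy, add_zero]
    | tmul s t =>
      rw [averagedDefectAux_tmul, Bialgebra.counit_mul, linearityDefect_tmul, map_sub,
        Bialgebra.counit_mul, hp, hp, Bialgebra.counit_mul,
        show counit (R := K) (ι t) = counit (R := K) t from CoalgHomClass.counit_comp_apply ι t,
        sub_self, mul_zero]

/-- The map `x ↦ p(x) + p(x₁)₁ D(S(p(x₁)₂) ⊗ x₂)`, where `D` is the defect of linearity of `p`. -/
def improveLinearity (p : E →ₗ[K] A) : E →ₗ[K] A :=
  p + averagedDefect ι p ∘ₗ p.rTensor E ∘ₗ comul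

theorem improveLinearity_apply_of_leftSlice {p : E →ₗ[K] A} {B : Submodule K E}
    (hB : ∀ b ∈ B, ∀ h : A, p (ι h * b) = h * p b) {x : E}
    (hx : ∀ f : Module.Dual K E, leftSlice f x ∈ B) : improveLinearity ι p x = p x := by
  obtain ⟨z, hz⟩ := comul_mem_range_lTensor_of_leftSlice hx
  simp only [improveLinearity, LinearMap.add_apply, LinearMap.comp_apply, ← hz, add_eq_left]
  clear hz
  induction z with
  | zero => simp
  | add x y hx hy => simp only [map_add, hx, hy, add_zero]
  | tmul a b => exact averagedDefect_tmul_eq_zero ι p _ (hB b b.2)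

theorem counit_improveLinearity {p : E →ₗ[K] A}
    (hp : ∀ x, counit (R := K) (p x) = counit (R := K) x) (x : E) :
    counit (R := K) (improveLinearity ι p x) = counit (R := K) x := by
  simp [improveLinearity, counit_averagedDefect ι hp, hp]

/-- `Δ(x)` lies in `H ⊗ E + E ⊗ B`. On `H ⊗ E` the map `p` inverts `ι`, so
`averagedDefect_comul_mul` applies; on `E ⊗ B` the defect vanishes. The error `-D(g ⊗ x)` of the
added term then cancels the defect of `p` at `x`. -/
theorem improveLinearity_mul {p : E →ₗ[K] A} (hι : ∀ h, p (ι h) = h) {B : Submodule K E}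
    (hB : ∀ b ∈ B, ∀ h : A, p (ι h * b) = h * p b) (hB' : ∀ b ∈ B, ∀ h : A, ι h * b ∈ B) {x : E}
    (hx : x ∈ wedge (LinearMap.range (ι : A →ₗ[K] E)) B) (g : A) :
    improveLinearity ι p (ι g * x) = g * improveLinearity ι p x := by
  have key : ∀ z ∈ wedgeTensor (LinearMap.range (ι : A →ₗ[K] E)) B,
      averagedDefect ι p (p.rTensor E (comul (ι g) * z)) =
        g * averagedDefect ι p (p.rTensor E z) -
          linearityDefect ι p (g ⊗ₜ TensorProduct.lid K E (counit.rTensor E z)) := by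
    intro z hz
    rw [comul_bialgHom]
    refine wedgeTensor_induction (p := fun z => averagedDefect ι p (p.rTensor E
      (TensorProduct.map (ι : A →ₗ[K] E) (ι : A →ₗ[K] E) (comul g) * z)) =
        g * averagedDefect ι p (p.rTensor E z) -
          linearityDefect ι p (g ⊗ₜ TensorProduct.lid K E (counit.rTensor E z)))
      ?_ ?_ ?_ ?_ hz
    · intro x y hx hy
      simp only [map_add, mul_add, TensorProduct.tmul_add, hx, hy]
      abel
    · simp
    · rintro _ ⟨h, rfl⟩ c
      have e : ∀ w : A ⊗[K] A, p.rTensor E (TensorProduct.map (ι : A →ₗ[K] E) (ι : A →ₗ[K] E) w *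
          (ι h ⊗ₜ c)) = TensorProduct.map (LinearMap.mulRight K h)
            (LinearMap.mulRight K c ∘ₗ (ι : A →ₗ[K] E)) w := by
        intro w
        induction w with
        | zero => simp
        | add x y hx hy => simp only [map_add, add_mul, hx, hy]
        | tmul a b => simp [← map_mul, hι]
      refine (congrArg _ (e _)).trans ?_
      rw [averagedDefect_comul_mul]
      simp [hι]
    · intro c b hb
      have e : ∀ w : A ⊗[K] A, averagedDefect ι p (p.rTensor E
          (TensorProduct.map (ι : A →ₗ[K] E) (ι : A →ₗ[K] E) w * (c ⊗ₜ b))) = 0 := by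
        intro w
        induction w with
        | zero => simp
        | add x y hx hy => simp only [map_add, add_mul, hx, hy, add_zero]
        | tmul s t =>
          simpa using averagedDefect_tmul_eq_zero ι p (p (ι s * c)) (hB _ (hB' b hb t))
      rw [e]
      simp [averagedDefect_tmul_eq_zero ι p (p c) (hB b hb), linearityDefect_tmul, hB b hb]
  have := key _ hx
  rw [← Bialgebra.comul_mul, Coalgebra.rTensor_counit_comul, TensorProduct.lid_tmul, one_smul,
    linearityDefect_tmul] at this
  simp only [improveLinearity, LinearMap.add_apply, LinearMap.comp_apply, this, mul_add]
  abel

theorem mul_mem_wedgePow (n : ℕ) {x : E} (hx : x ∈ wedgePow (LinearMap.range (ι : A →ₗ[K] E)) n)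
    (g : A) : ι g * x ∈ wedgePow (LinearMap.range (ι : A →ₗ[K] E)) n := by
  induction n generalizing x g with
  | zero =>
    obtain ⟨h, rfl⟩ := hx
    exact ⟨g * h, map_mul ι g h⟩
  | succ n ih =>
    refine mem_wedge.mpr ?_
    rw [Bialgebra.comul_mul, comul_bialgHom]
    generalize comul (R := K) g = w
    induction w with
    | zero => simp
    | add x y hx hy => rw [map_add, add_mul]; exact add_mem hx hy
    | tmul s t =>
      refine wedgeTensor_induction (p := fun z => TensorProduct.map (ι : A →ₗ[K] E)
        (ι : A →ₗ[K] E) (s ⊗ₜ t) * z ∈ wedgeTensor (LinearMap.range (ι : A →ₗ[K] E))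
          (wedgePow (LinearMap.range (ι : A →ₗ[K] E)) n)) ?_ ?_ ?_ ?_ hx
      · intro x y hx hy
        rw [mul_add]
        exact add_mem hx hy
      · simp
      · rintro _ ⟨h, rfl⟩ c
        have hm : ι s * ι h ∈ LinearMap.range (ι : A →ₗ[K] E) := ⟨s * h, map_mul ι s h⟩
        rw [TensorProduct.map_tmul, Algebra.TensorProduct.tmul_mul_tmul]
        exact tmul_mem_wedgeTensor_left _ hm (ι t * c)
      · intro c d hd
        rw [TensorProduct.map_tmul, Algebra.TensorProduct.tmul_mul_tmul]
        exact tmul_mem_wedgeTensor_right (LinearMap.range (ι : A →ₗ[K] E)) (ι s * c) (ih hd t)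

theorem isSubcoalgebra_range : IsSubcoalgebra K (LinearMap.range (ι : A →ₗ[K] E)) := by
  rintro _ ⟨h, rfl⟩
  refine ⟨TensorProduct.map (ι : A →ₗ[K] E).rangeRestrict (ι : A →ₗ[K] E).rangeRestrict
    (comul h), ?_⟩
  rw [← LinearMap.comp_apply, ← TensorProduct.map_comp]
  exact (comul_bialgHom ι h).symm

/-- Linear maps that agree on an exhausting sequence of subspaces have a limit. -/
theorem exists_linearMap_limit {R M N : Type*} [Ring R] [AddCommGroup M] [Module R M]
    [AddCommGroup N] [Module R N] {F : ℕ → Submodule R M} (hF : Monotone F)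
    (hF' : ∀ x, ∃ n, x ∈ F n) (p : ℕ → M →ₗ[R] N) (hp : ∀ n, ∀ x ∈ F n, p (n + 1) x = p n x) :
    ∃ q : M →ₗ[R] N, ∀ n, ∀ x ∈ F n, q x = p n x := by
  choose k hk using hF'
  have hp' : ∀ m n, m ≤ n → ∀ x ∈ F m, p n x = p m x := by
    intro m n hmn x hx
    induction n, hmn using Nat.le_induction with
    | base => rfl
    | succ n hmn ih => rw [hp n x (hF hmn hx), ih]
  have hp2 : ∀ n, ∀ x ∈ F n, p (k x) x = p n x := by
    intro n x hx
    rw [← hp' _ _ (le_max_left n (k x)) x hx, hp' _ _ (le_max_right n (k x)) x (hk x)]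
  refine ⟨{ toFun := fun x => p (k x) x, map_add' := fun x y => ?_, map_smul' := fun c x => ?_ },
    hp2⟩
  · have hx := hF (le_max_left (k x) (k y)) (hk x)
    have hy := hF (le_max_right (k x) (k y)) (hk y)
    rw [hp2 _ _ (add_mem hx hy), hp2 _ _ hx, hp2 _ _ hy, map_add]
  · rw [hp2 _ _ (Submodule.smul_mem _ c (hk x)), map_smul, RingHom.id_apply]

/-- If the wedge powers of `A` exhaust `E`, then there is a left `A`-linear, counital retraction
of `A → E`. -/
theorem exists_linear_retraction (hι : Function.Injective ι)
    (hex : ∀ x : E, ∃ n, x ∈ wedgePow (LinearMap.range (ι : A →ₗ[K] E)) n) :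
    ∃ p : E →ₗ[K] A, (∀ h, p (ι h) = h) ∧ (∀ x, counit (R := K) (p x) = counit (R := K) x) ∧
      ∀ h x, p (ι h * x) = h * p x := by
  have hsub := isSubcoalgebra_range (K := K) ι
  have hmono := wedgePow_mono hsub
  have hι0 : ∀ n h, ι h ∈ wedgePow (LinearMap.range (ι : A →ₗ[K] E)) n :=
    fun n h => hmono (Nat.zero_le n) ⟨h, rfl⟩
  obtain ⟨r, hr⟩ := LinearMap.exists_leftInverse_of_injective (ι : A →ₗ[K] E)
    (LinearMap.ker_eq_bot.mpr hι)
  -- Adding a scalar multiple of `1` makes the retraction counital; the term vanishes on `H`, where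
  -- `r` already preserves the counit.
  let p0 : E →ₗ[K] A := r + Algebra.linearMap K A ∘ₗ (counit - counit ∘ₗ r)
  let P : ℕ → E →ₗ[K] A := fun n => (improveLinearity ι)^[n] p0
  have hP : ∀ n, P (n + 1) = improveLinearity ι (P n) :=
    fun n => Function.iterate_succ_apply' _ _ _
  have inv : ∀ n, (∀ h, P n (ι h) = h) ∧ (∀ x, counit (R := K) (P n x) = counit (R := K) x) ∧
      ∀ x ∈ wedgePow (LinearMap.range (ι : A →ₗ[K] E)) n, ∀ h, P n (ι h * x) = h * P n x := by
    intro n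
    induction n with
    | zero =>
      have h0 : ∀ h, P 0 (ι h) = h := by
        intro h
        have : r (ι h) = h := LinearMap.congr_fun hr h
        have hc : counit (R := K) (ι h) = counit (R := K) h := CoalgHomClass.counit_comp_apply ι h
        simp [P, p0, this, hc]
      refine ⟨h0, fun x => by simp [P, p0], ?_⟩
      rintro _ ⟨h, rfl⟩ g
      have : P 0 (ι (g * h)) = g * P 0 (ι h) := by rw [h0, h0]
      rwa [map_mul] at this
    | succ n ih =>
      obtain ⟨h1, h2, h3⟩ := ih
      rw [hP]
      refine ⟨fun h => ?_, counit_improveLinearity ι h2, fun x hx h => ?_⟩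
      · rw [improveLinearity_apply_of_leftSlice ι h3
          fun f => leftSlice_mem_wedgePow hsub n f (hι0 n h), h1]
      · exact improveLinearity_mul ι h1 h3 (fun b hb g => mul_mem_wedgePow ι n hb g) hx h
  obtain ⟨p, hp⟩ := exists_linearMap_limit hmono hex P fun n x hx => by
    rw [hP]
    exact improveLinearity_apply_of_leftSlice ι (inv n).2.2
      fun f => leftSlice_mem_wedgePow hsub n f hx
  refine ⟨p, fun h => ?_, fun x => ?_, fun h x => ?_⟩
  · rw [hp 0 _ (hι0 0 h), (inv 0).1]
  · obtain ⟨n, hn⟩ := hex x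
    rw [hp n x hn, (inv n).2.1]
  · obtain ⟨n, hn⟩ := hex x
    rw [hp n x hn, hp n _ (mul_mem_wedgePow ι n hn h), (inv n).2.2 x hn]

end LinearRetraction

/-! ### Correcting the comultiplicative defect -/

section WeakProjection

open HopfAlgebra (antipode)

variable {K : Type u} {A E : Type v} [Field K] [Ring A] [HopfAlgebra K A] [Ring E] [Bialgebra K E]
  (ι : A →ₐc[K] E)

variable (K A) in
/-- A linear map `θ : A ⊗ (A ⊗ A) → A` with `θ(a ⊗ Δ(b)) = 0` and `θ(Δ(b) ⊗ d) = ε(d) b - ε(b) d`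
that is linear for the diagonal action of `A`, and a coderivation in the two outer variables. -/
structure IsSplittingMap (θ : A ⊗[K] (A ⊗[K] A) →ₗ[K] A) : Prop where
  counit_apply : ∀ y, counit (R := K) (θ y) = 0
  map_mul : ∀ g y, θ (comul.lTensor A (comul g) * y) = g * θ y
  tmul_comul : ∀ a b, θ (a ⊗ₜ comul b) = 0
  comul_tmul : ∀ b d, θ (TensorProduct.assoc K A A A (comul b ⊗ₜ d)) =
    counit (R := K) d • b - counit (R := K) b • d
  comul_apply : ∀ a z, comul (θ (a ⊗ₜ z)) =
    θ.rTensor A ((TensorProduct.assoc K A (A ⊗[K] A) A).symm (a ⊗ₜ comulRight K A z)) +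
      θ.lTensor A (TensorProduct.assoc K A A (A ⊗[K] A) (comul a ⊗ₜ z))

theorem IsFormallySmoothCoalgebra.exists_isSplittingMap (hA : IsFormallySmoothCoalgebra K A) :
    ∃ θ, IsSplittingMap K A θ := by
  obtain ⟨ψ, h0, h1, h2, h3⟩ := hA.exists_coderivation
  exact ⟨averaged ψ, counit_averaged h0, averaged_linear ψ, averaged_tmul_comul h1,
    averaged_comul_tmul h2, comul_averaged h3⟩

/-- The map `x ↦ θ(p(x₁) ⊗ p(x₂) ⊗ p(x₃))`. -/
def correction (θ : A ⊗[K] (A ⊗[K] A) →ₗ[K] A) (p : E →ₗ[K] A) : E →ₗ[K] A :=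
  θ ∘ₗ TensorProduct.map p (TensorProduct.map p p) ∘ₗ comul.lTensor E ∘ₗ comul

/-- The failure `(p ⊗ p) Δ - Δ p` of `p` to preserve comultiplication. -/
def comulDefect (p : E →ₗ[K] A) : E →ₗ[K] A ⊗[K] A :=
  TensorProduct.map p p ∘ₗ comul - comul ∘ₗ p

theorem map_comul_eq (p : E →ₗ[K] A) (x : E) :
    TensorProduct.map p p (comul x) = comul (p x) + comulDefect p x := by
  simp [comulDefect]

theorem counit_comulDefect {p : E →ₗ[K] A}
    (hp : ∀ x, counit (R := K) (p x) = counit (R := K) x) (x : E) :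
    TensorProduct.lid K A (counit.rTensor A (comulDefect p x)) = 0 := by
  have h : ∀ z : E ⊗[K] E, TensorProduct.lid K A (counit.rTensor A (TensorProduct.map p p z)) =
      p (TensorProduct.lid K E (counit.rTensor E z)) := by
    intro z
    induction z with
    | zero => simp
    | add x y hx hy => simp only [map_add, hx, hy]
    | tmul a b => simp [hp]
  rw [comulDefect, LinearMap.sub_apply, map_sub, map_sub, LinearMap.comp_apply,
    LinearMap.comp_apply, h]
  simp

variable {θ : A ⊗[K] (A ⊗[K] A) →ₗ[K] A} (hθ : IsSplittingMap K A θ)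

include hθ

/-- `p ⊗ p ⊗ p` after the iterated comultiplication turns the action of `h` into its diagonal
action, for which `θ` is linear. This is what the averaging was for. -/
theorem correction_mul {p : E →ₗ[K] A} (hp : ∀ h x, p (ι h * x) = h * p x) (h : A) (x : E) :
    correction θ p (ι h * x) = h * correction θ p x := by
  have h1 : ∀ (w : A ⊗[K] A) (z : E ⊗[K] E), TensorProduct.map p p
      (TensorProduct.map (ι : A →ₗ[K] E) (ι : A →ₗ[K] E) w * z) =
        w * TensorProduct.map p p z := by
    intro w z
    induction w with
    | zero => simp
    | add x y hx hy => simp only [map_add, add_mul, hx, hy]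
    | tmul a b =>
      induction z with
      | zero => simp
      | add x y hx hy => simp only [map_add, mul_add, hx, hy]
      | tmul c d => simp [hp]
  have h2 : ∀ (w : A ⊗[K] A) (z : E ⊗[K] E), TensorProduct.map p (TensorProduct.map p p)
      (comul.lTensor E (TensorProduct.map (ι : A →ₗ[K] E) (ι : A →ₗ[K] E) w * z)) =
      comul.lTensor A w * TensorProduct.map p (TensorProduct.map p p) (comul.lTensor E z) := by
    intro w z
    induction w with
    | zero => simp
    | add x y hx hy => simp only [map_add, add_mul, hx, hy]
    | tmul a b =>
      induction z with
      | zero => simp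
      | add x y hx hy => simp only [map_add, mul_add, hx, hy]
      | tmul c d =>
        have e := comul_bialgHom ι b
        rw [TensorProduct.map_tmul, Algebra.TensorProduct.tmul_mul_tmul, LinearMap.lTensor_tmul,
          Bialgebra.comul_mul]
        refine (congrArg (fun t => TensorProduct.map p (TensorProduct.map p p)
          ((ι a * c) ⊗ₜ (t * comul d))) e).trans ?_
        rw [TensorProduct.map_tmul, hp, h1, LinearMap.lTensor_tmul, LinearMap.lTensor_tmul,
          TensorProduct.map_tmul, Algebra.TensorProduct.tmul_mul_tmul]
  simp only [correction, LinearMap.comp_apply]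
  rw [Bialgebra.comul_mul, comul_bialgHom, h2, hθ.map_mul]

/-- The second leg of `Δ(x)` lies in `B`, so the last two arguments of `θ` form `Δ(p(x₂))`, and `θ(a
⊗ Δ(b)) = 0`. -/
theorem correction_apply_of_leftSlice {p : E →ₗ[K] A} {B : Submodule K E}
    (hB : ∀ b ∈ B, comulDefect p b = 0) {x : E}
    (hx : ∀ f : Module.Dual K E, leftSlice f x ∈ B) : correction θ p x = 0 := by
  obtain ⟨z, hz⟩ := comul_mem_range_lTensor_of_leftSlice hx
  simp only [correction, LinearMap.comp_apply, ← hz]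
  clear hz
  induction z with
  | zero => simp
  | add x y hx hy => simp only [map_add, hx, hy, add_zero]
  | tmul a b =>
    have := map_comul_eq p (b : E)
    rw [hB b b.2, add_zero] at this
    simp [this, hθ.tmul_comul]

theorem rTensor_splittingMap_comul (a : A) (w : A ⊗[K] A)
    (hw : TensorProduct.lid K A (counit.rTensor A w) = 0) :
    θ.rTensor A ((TensorProduct.assoc K A A A).toLinearMap.rTensor A
      ((TensorProduct.assoc K (A ⊗[K] A) A A).symm (comul a ⊗ₜ w))) =
      - (counit (R := K) a • w) := by
  have h : ∀ w : A ⊗[K] A, θ.rTensor A ((TensorProduct.assoc K A A A).toLinearMap.rTensor A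
      ((TensorProduct.assoc K (A ⊗[K] A) A A).symm (comul a ⊗ₜ w))) =
      a ⊗ₜ TensorProduct.lid K A (counit.rTensor A w) - counit (R := K) a • w := by
    intro w
    induction w with
    | zero => simp
    | add x y hx hy => simp only [TensorProduct.tmul_add, map_add, smul_add, hx, hy]; abel
    | tmul d e =>
      have := hθ.comul_tmul a d
      simp [this, TensorProduct.sub_tmul, TensorProduct.smul_tmul]
  rw [h, hw, TensorProduct.tmul_zero, zero_sub]

omit hθ in
-- Rebrackets the fourfold comultiplication as `Δ(x₁) ⊗ Δ(x₂)`, so that a condition on `Δ(x)` can be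
-- used.
theorem comul_four_left (x : E) :
    (comul.lTensor E ∘ₗ comul).rTensor E (comul (R := K) x) =
      (TensorProduct.assoc K E E E).toLinearMap.rTensor E
        ((TensorProduct.assoc K (E ⊗[K] E) E E).symm
          (TensorProduct.map comul comul (comul (R := K) x))) := by
  have h : (comul.lTensor E ∘ₗ comul).rTensor E ∘ₗ comul (R := K) =
      (TensorProduct.assoc K E E E).toLinearMap.rTensor E ∘ₗ
        (TensorProduct.assoc K (E ⊗[K] E) E E).symm.toLinearMap ∘ₗ
          TensorProduct.map comul comul ∘ₗ comul (R := K) (A := E) := by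
    simp only [coassoc_simps]
  exact LinearMap.congr_fun h x

omit hθ in
theorem comul_four_right (x : E) :
    (comul.lTensor E ∘ₗ comul).lTensor E (comul (R := K) x) =
      TensorProduct.assoc K E E (E ⊗[K] E)
          (TensorProduct.map comul comul (comul (R := K) x)) := by
  have h : (comul.lTensor E ∘ₗ comul).lTensor E ∘ₗ comul (R := K) =
      (TensorProduct.assoc K E E (E ⊗[K] E)).toLinearMap ∘ₗ
          TensorProduct.map comul comul ∘ₗ comul (R := K) (A := E) := by
    simp only [coassoc_simps]
  exact LinearMap.congr_fun h x

omit hθ in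
theorem rTensor_comul_tmul_eq (p : E →ₗ[K] A) (x : E) :
    TensorProduct.map (correction θ p) p (comul x) =
      θ.rTensor A ((TensorProduct.assoc K A A A).toLinearMap.rTensor A
        ((TensorProduct.assoc K (A ⊗[K] A) A A).symm (TensorProduct.map
          (TensorProduct.map p p ∘ₗ comul) (TensorProduct.map p p ∘ₗ comul) (comul x)))) := by
  have h : θ.rTensor A ∘ₗ TensorProduct.map (TensorProduct.map p (TensorProduct.map p p)) p ∘ₗ
      (TensorProduct.assoc K E E E).toLinearMap.rTensor E ∘ₗ
        (TensorProduct.assoc K (E ⊗[K] E) E E).symm.toLinearMap =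
      θ.rTensor A ∘ₗ (TensorProduct.assoc K A A A).toLinearMap.rTensor A ∘ₗ
        (TensorProduct.assoc K (A ⊗[K] A) A A).symm.toLinearMap ∘ₗ
          TensorProduct.map (TensorProduct.map p p) (TensorProduct.map p p) := by
    ext
    simp
  have h' := LinearMap.congr_fun h (TensorProduct.map comul comul (comul (R := K) x))
  simp only [LinearMap.comp_apply, LinearEquiv.coe_coe] at h'
  rw [← comul_four_left] at h'
  have h2 : TensorProduct.map (correction θ p) p = θ.rTensor A ∘ₗ
      TensorProduct.map (TensorProduct.map p (TensorProduct.map p p)) p ∘ₗ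
        (comul.lTensor E ∘ₗ comul).rTensor E := by
    rw [LinearMap.rTensor, LinearMap.rTensor, ← TensorProduct.map_comp, ← TensorProduct.map_comp]
    rfl
  rw [TensorProduct.map_comp, LinearMap.comp_apply, ← h', h2]
  rfl

omit hθ in
theorem lTensor_comul_tmul_eq (p : E →ₗ[K] A) (x : E) :
    TensorProduct.map p (correction θ p) (comul x) =
      θ.lTensor A (TensorProduct.assoc K A A (A ⊗[K] A) (TensorProduct.map
          (TensorProduct.map p p ∘ₗ comul) (TensorProduct.map p p ∘ₗ comul) (comul x))) := by
  have h : θ.lTensor A ∘ₗ TensorProduct.map p (TensorProduct.map p (TensorProduct.map p p)) ∘ₗ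
      (TensorProduct.assoc K E E (E ⊗[K] E)).toLinearMap =
      θ.lTensor A ∘ₗ (TensorProduct.assoc K A A (A ⊗[K] A)).toLinearMap ∘ₗ
          TensorProduct.map (TensorProduct.map p p) (TensorProduct.map p p) := by
    ext
    simp
  have h' := LinearMap.congr_fun h (TensorProduct.map comul comul (comul (R := K) x))
  simp only [LinearMap.comp_apply, LinearEquiv.coe_coe] at h'
  rw [← comul_four_right] at h'
  have h2 : TensorProduct.map p (correction θ p) = θ.lTensor A ∘ₗ
      TensorProduct.map p (TensorProduct.map p (TensorProduct.map p p)) ∘ₗ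
        (comul.lTensor E ∘ₗ comul).lTensor E := by
    rw [LinearMap.lTensor, LinearMap.lTensor, ← TensorProduct.map_comp, ← TensorProduct.map_comp]
    rfl
  rw [TensorProduct.map_comp, LinearMap.comp_apply, ← h', h2]
  rfl

/-- The coderivation rule for `θ`. The result differs from `T(x₁) ⊗ p(x₂) + p(x₁) ⊗ T(x₂)`, with `T`
the correction, only in having `Δ p` where that has `(p ⊗ p) Δ` on one outer leg. -/
theorem comul_correction (p : E →ₗ[K] A) (x : E) :
    comul (correction θ p x) =
      θ.rTensor A ((TensorProduct.assoc K A A A).toLinearMap.rTensor A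
        ((TensorProduct.assoc K (A ⊗[K] A) A A).symm (TensorProduct.map
          (TensorProduct.map p p ∘ₗ comul) (comul ∘ₗ p) (comul x)))) +
      θ.lTensor A (TensorProduct.assoc K A A (A ⊗[K] A) (TensorProduct.map
          (comul ∘ₗ p) (TensorProduct.map p p ∘ₗ comul) (comul x))) := by
  let Q : E ⊗[K] (E ⊗[K] E) →ₗ[K] A ⊗[K] A := θ.rTensor A ∘ₗ
    (TensorProduct.assoc K A (A ⊗[K] A) A).symm.toLinearMap ∘ₗ (comulRight K A).lTensor A ∘ₗ
      TensorProduct.map p (TensorProduct.map p p)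
  have e1 : ∀ z : E ⊗[K] E,
      comul (θ (TensorProduct.map p (TensorProduct.map p p) (comul.lTensor E z))) =
      Q (comul.lTensor E z) + θ.lTensor A (TensorProduct.assoc K A A (A ⊗[K] A)
        (TensorProduct.map (comul ∘ₗ p) (TensorProduct.map p p ∘ₗ comul) z)) := by
    intro z
    induction z with
    | zero => simp
    | add x y hx hy => simp only [map_add, hx, hy]; abel
    | tmul u v =>
      rw [LinearMap.lTensor_tmul, TensorProduct.map_tmul, hθ.comul_apply]
      rfl
  have e2 : ∀ z : E ⊗[K] E, Q (TensorProduct.assoc K E E E (comul.rTensor E z)) =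
      θ.rTensor A ((TensorProduct.assoc K A A A).toLinearMap.rTensor A
        ((TensorProduct.assoc K (A ⊗[K] A) A A).symm (TensorProduct.map
          (TensorProduct.map p p ∘ₗ comul) (comul ∘ₗ p) z))) := by
    intro z
    induction z with
    | zero => simp
    | add x y hx hy => simp only [map_add, hx, hy]
    | tmul u v =>
      simp only [LinearMap.rTensor_tmul, TensorProduct.map_tmul, LinearMap.comp_apply]
      generalize comul (R := K) u = w
      induction w with
      | zero => simp
      | add x y hx hy => simp only [map_add, TensorProduct.add_tmul, hx, hy]
      | tmul s t =>
        simp only [Q, LinearMap.comp_apply, TensorProduct.assoc_tmul, TensorProduct.map_tmul,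
          LinearMap.lTensor_tmul, LinearEquiv.coe_coe]
        generalize comul (R := K) (p v) = w
        induction w with
        | zero => simp
        | add x y hx hy => simp only [map_add, TensorProduct.tmul_add, hx, hy]
        | tmul c d => simp
  rw [← e2, coassoc_apply, ← e1]
  rfl

/-- With `ω` the defect of `p` and `T` the correction, the new defect is `ω + (T ⊗ p + p ⊗ T) Δ - Δ
T + (T ⊗ T) Δ`. Comparison with `comul_correction` leaves two terms in which `θ` meets `ω`: on `B ∧
B` one equals `-ω(x)` and the other vanishes. -/
theorem comulDefect_add_correction {p : E →ₗ[K] A}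
    (hp : ∀ x, counit (R := K) (p x) = counit (R := K) x) {B : Submodule K E}
    (hB : ∀ b ∈ B, comulDefect p b = 0) (hBl : ∀ b ∈ B, ∀ f : Module.Dual K E, leftSlice f b ∈ B)
    {x : E} (hx : x ∈ wedge B B) : comulDefect (p + correction θ p) x = 0 := by
  have hT : ∀ b ∈ B, correction θ p b = 0 :=
    fun b hb => correction_apply_of_leftSlice hθ hB (hBl b hb)
  have hB' : ∀ b ∈ B, TensorProduct.map p p (comul b) = comul (p b) := by
    intro b hb
    rw [map_comul_eq, hB b hb, add_zero]
  -- On `B ⊗ E` the left factor is `Δ(p(b))`, where `θ` is explicit and `(ε ⊗ A) ω = 0` leaves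
  -- `-ε(b) ω(c)`; on `E ⊗ B` both sides vanish.
  have e1 : θ.rTensor A ((TensorProduct.assoc K A A A).toLinearMap.rTensor A
        ((TensorProduct.assoc K (A ⊗[K] A) A A).symm (TensorProduct.map
          (TensorProduct.map p p ∘ₗ comul) (comulDefect p) (comul x)))) =
      - comulDefect p (TensorProduct.lid K E (counit.rTensor E (comul x))) := by
    refine wedgeTensor_induction (p := fun z =>
      θ.rTensor A ((TensorProduct.assoc K A A A).toLinearMap.rTensor A
        ((TensorProduct.assoc K (A ⊗[K] A) A A).symm (TensorProduct.map
          (TensorProduct.map p p ∘ₗ comul) (comulDefect p) z))) =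
      - comulDefect p (TensorProduct.lid K E (counit.rTensor E z))) ?_ ?_ ?_ ?_ hx
    · intro x y hx hy
      simp only [map_add, hx, hy]
      abel
    · simp
    · intro b hb c
      rw [TensorProduct.map_tmul, LinearMap.comp_apply, hB' b hb,
        rTensor_splittingMap_comul hθ _ _ (counit_comulDefect hp c), hp]
      simp
    · intro c b hb
      simp [hB b hb]
  have e2 : θ.lTensor A (TensorProduct.assoc K A A (A ⊗[K] A) (TensorProduct.map
      (comulDefect p) (TensorProduct.map p p ∘ₗ comul) (comul x))) = 0 := by
    refine wedgeTensor_induction (p := fun z =>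
      θ.lTensor A (TensorProduct.assoc K A A (A ⊗[K] A) (TensorProduct.map
        (comulDefect p) (TensorProduct.map p p ∘ₗ comul) z)) = 0) ?_ ?_ ?_ ?_ hx
    · intro x y hx hy
      simp only [map_add, hx, hy, add_zero]
    · simp
    · intro b hb c
      simp [hB b hb]
    · intro c b hb
      rw [TensorProduct.map_tmul, LinearMap.comp_apply, hB' b hb]
      generalize comulDefect p c = w
      induction w with
      | zero => simp
      | add x y hx hy => simp only [map_add, TensorProduct.add_tmul, hx, hy, add_zero]
      | tmul s t =>
        rw [TensorProduct.assoc_tmul, LinearMap.lTensor_tmul, hθ.tmul_comul,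
          TensorProduct.tmul_zero]
  have e3 : TensorProduct.map (correction θ p) (correction θ p) (comul x) = 0 := by
    refine wedgeTensor_induction (p := fun z =>
      TensorProduct.map (correction θ p) (correction θ p) z = 0) ?_ ?_ ?_ ?_ hx
    · intro x y hx hy
      rw [map_add, hx, hy, add_zero]
    · simp
    · intro b hb c
      simp [hT b hb]
    · intro c b hb
      simp [hT b hb]
  have e4 : TensorProduct.map p p ∘ₗ comul = comul ∘ₗ p + comulDefect p := by
    simp [comulDefect]
  have e5 := rTensor_comul_tmul_eq (θ := θ) p x
  have e6 := lTensor_comul_tmul_eq (θ := θ) p x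
  have e7 := comul_correction hθ p x
  have e8 : TensorProduct.map (TensorProduct.map p p ∘ₗ comul) (TensorProduct.map p p ∘ₗ comul)
      (comul x) = TensorProduct.map (TensorProduct.map p p ∘ₗ comul) (comul ∘ₗ p) (comul x) +
        TensorProduct.map (TensorProduct.map p p ∘ₗ comul) (comulDefect p) (comul x) := by
    rw [← LinearMap.add_apply, ← TensorProduct.map_add_right, ← e4]
  have e9 : TensorProduct.map (TensorProduct.map p p ∘ₗ comul) (TensorProduct.map p p ∘ₗ comul)
      (comul x) = TensorProduct.map (comul ∘ₗ p) (TensorProduct.map p p ∘ₗ comul) (comul x) +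
        TensorProduct.map (comulDefect p) (TensorProduct.map p p ∘ₗ comul) (comul x) := by
    rw [← LinearMap.add_apply, ← TensorProduct.map_add_left, ← e4]
  rw [e8] at e5
  rw [e9] at e6
  simp only [map_add, e1, e2, Coalgebra.rTensor_counit_comul, TensorProduct.lid_tmul, one_smul,
    add_zero] at e5 e6
  rw [comulDefect, LinearMap.sub_apply, LinearMap.comp_apply, LinearMap.comp_apply,
    TensorProduct.map_add_left, LinearMap.add_apply, TensorProduct.map_add_right,
    TensorProduct.map_add_right, LinearMap.add_apply, LinearMap.add_apply, e3, e5, e6,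
    LinearMap.add_apply, map_add, e7, map_comul_eq]
  abel

/-- If `θ` is a splitting map for `A` and the wedge powers of `A` exhaust `E`, then a left
`A`-linear counital retraction of `A → E` can be corrected to a weak projection. -/
theorem exists_weak_projection
    (hex : ∀ x : E, ∃ n, x ∈ wedgePow (LinearMap.range (ι : A →ₗ[K] E)) n)
    {p : E →ₗ[K] A} (h1 : ∀ h, p (ι h) = h) (h2 : ∀ x, counit (R := K) (p x) = counit (R := K) x)
    (h3 : ∀ h x, p (ι h * x) = h * p x) :
    ∃ π : E →ₗc[K] A, (∀ h, π (ι h) = h) ∧ ∀ h x, π (ι h * x) = h * π x := by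
  have hsub := isSubcoalgebra_range (K := K) ι
  have hmono := wedgePow_mono hsub
  have hι0 : ∀ n h, ι h ∈ wedgePow (LinearMap.range (ι : A →ₗ[K] E)) n :=
    fun n h => hmono (Nat.zero_le n) ⟨h, rfl⟩
  let P : ℕ → E →ₗ[K] A := fun n => (fun q => q + correction θ q)^[n] p
  have hP : ∀ n, P (n + 1) = P n + correction θ (P n) :=
    fun n => Function.iterate_succ_apply' _ _ _
  have inv : ∀ n, (∀ h, P n (ι h) = h) ∧ (∀ x, counit (R := K) (P n x) = counit (R := K) x) ∧
      (∀ h x, P n (ι h * x) = h * P n x) ∧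
      ∀ x ∈ wedgePow (LinearMap.range (ι : A →ₗ[K] E)) n, comulDefect (P n) x = 0 := by
    intro n
    induction n with
    | zero =>
      refine ⟨h1, h2, h3, ?_⟩
      rintro _ ⟨h, rfl⟩
      have e : p ∘ₗ (ι : A →ₗ[K] E) = LinearMap.id := LinearMap.ext h1
      have e' : TensorProduct.map p p (comul (ι h)) = comul h := by
        rw [comul_bialgHom, ← LinearMap.comp_apply, ← TensorProduct.map_comp, e,
          TensorProduct.map_id, LinearMap.id_apply]
      exact sub_eq_zero.mpr (e'.trans (congrArg _ (h1 h).symm))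
    | succ n ih =>
      obtain ⟨g1, g2, g3, g4⟩ := ih
      rw [hP]
      refine ⟨fun h => ?_, fun x => ?_, fun h x => ?_, fun x hx => ?_⟩
      · rw [LinearMap.add_apply, g1, correction_apply_of_leftSlice hθ g4
          (fun f => leftSlice_mem_wedgePow hsub n f (hι0 n h)), add_zero]
      · rw [LinearMap.add_apply, map_add, g2, correction, LinearMap.comp_apply,
          hθ.counit_apply, add_zero]
      · rw [LinearMap.add_apply, LinearMap.add_apply, g3, correction_mul ι hθ g3, mul_add]
      -- The next layer is `H ∧ B` with `B` the current one; it lies in `B ∧ B` because `H ⊆ B`.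
      · exact comulDefect_add_correction hθ g2 g4
          (fun b hb f => leftSlice_mem_wedgePow hsub n f hb)
          (wedgeTensor_mono (hmono (Nat.zero_le n)) le_rfl hx)
  obtain ⟨q, hq⟩ := exists_linearMap_limit hmono hex P fun n x hx => by
    rw [hP, LinearMap.add_apply, correction_apply_of_leftSlice hθ (inv n).2.2.2
      (fun f => leftSlice_mem_wedgePow hsub n f hx), add_zero]
  -- Comultiplicativity at `x` involves all of `Δ(x)`, so a stage is needed from which `q ⊗ q`
  -- agrees with `P n ⊗ P n` on a whole tensor.
  have hlim : ∀ z : E ⊗[K] E, ∃ m, ∀ n, m ≤ n →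
      TensorProduct.map q q z = TensorProduct.map (P n) (P n) z := by
    intro z
    induction z with
    | zero => exact ⟨0, by simp⟩
    | add x y hx hy =>
      obtain ⟨k, hk⟩ := hx
      obtain ⟨l, hl⟩ := hy
      exact ⟨max k l, fun n hn => by
        rw [map_add, map_add, hk n (le_of_max_le_left hn), hl n (le_of_max_le_right hn)]⟩
    | tmul a b =>
      obtain ⟨k, hk⟩ := hex a
      obtain ⟨l, hl⟩ := hex b
      exact ⟨max k l, fun n hn => by
        rw [TensorProduct.map_tmul, TensorProduct.map_tmul, hq n a (hmono (le_of_max_le_left hn) hk),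
          hq n b (hmono (le_of_max_le_right hn) hl)]⟩
  refine ⟨{ q with counit_comp := ?_, map_comp_comul := ?_ }, fun h => ?_, fun h x => ?_⟩
  · ext x
    obtain ⟨n, hn⟩ := hex x
    change counit (R := K) (q x) = _
    rw [hq n x hn, (inv n).2.1]
  · ext x
    obtain ⟨n, hn⟩ := hex x
    obtain ⟨m, hm⟩ := hlim (comul x)
    have hd : comulDefect q x = 0 := by
      have hx := hmono (le_max_right m n) hn
      rw [← (inv (max m n)).2.2.2 x hx, comulDefect, comulDefect, LinearMap.sub_apply,
        LinearMap.sub_apply, LinearMap.comp_apply, LinearMap.comp_apply, LinearMap.comp_apply,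
        LinearMap.comp_apply, hq _ x hx, hm _ (le_max_left m n)]
    exact sub_eq_zero.mp hd
  · exact (hq 0 _ (hι0 0 h)).trans ((inv 0).1 h)
  · obtain ⟨n, hn⟩ := hex x
    change q (ι h * x) = h * q x
    rw [hq n x hn, hq n _ (mul_mem_wedgePow ι n hn h), (inv n).2.2.1]

end WeakProjection

/-! ### Application to the inclusion of `H` -/

/-- The inclusion of a sub-bialgebra as a bialgebra homomorphism. -/
def Subbialgebra.inclusion {K : Type u} {E : Type v} [Field K] [Ring E] [Bialgebra K E]
    (B : Subbialgebra K E) : B.toSubalgebra →ₐc[K] E :=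
  BialgHom.ofAlgHom B.toSubalgebra.val rfl (AlgHom.ext fun x => B.map_val_comul x)

end

theorem mainTheorem5 {K : Type u} {E : Type v} [Field K] [Ring E] [Bialgebra K E]
    (H : HopfSubalgebra K E)
    (hsmooth : IsFormallySmoothCoalgebra K H.toSubalgebra)
    (hcorad : Corad K E ≤ Subalgebra.toSubmodule H.toSubalgebra) :
    ∃ π : E →ₗc[K] H.toSubalgebra, H.IsWeakProjection π := by
  let ι : H.toSubalgebra →ₐc[K] E := H.toSubbialgebra.inclusion
  have hι : LinearMap.range (ι : H.toSubalgebra →ₗ[K] E) =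
      Subalgebra.toSubmodule H.toSubalgebra :=
    Submodule.range_subtype (Subalgebra.toSubmodule H.toSubalgebra)
  have hex : ∀ x : E, ∃ n, x ∈ wedgePow (LinearMap.range (ι : H.toSubalgebra →ₗ[K] E)) n :=
    exists_mem_wedgePow (isSubcoalgebra_range ι) (hcorad.trans_eq hι.symm)
  obtain ⟨θ, hθ⟩ := hsmooth.exists_isSplittingMap
  obtain ⟨p, h1, h2, h3⟩ := exists_linear_retraction ι Subtype.val_injective hex
  obtain ⟨π, g1, g2⟩ := exists_weak_projection ι hθ hex h1 h2 h3
  exact ⟨π, g1, g2⟩
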